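/- **Theorem 4.2.** Let $\alpha_0,\dots,\alpha_4\in\mathbb C$ satisfy $\alpha_0+\alpha_1+\alpha_2+\alpha_3+\alpha_4=1$, and let $H\in\mathbb C(t)[x,y,z,w,q,p]$. Consider the Hamiltonian system $$\frac{dx}{dt}=\frac{\partial H}{\partial y},\quad \frac{dy}{dt}=-\frac{\partial H}{\partial x},\quad \frac{dz}{dt}=\frac{\partial H}{\partial w},\quad \frac{dw}{dt}=-\frac{\partial H}{\partial z},\quad \frac{dq}{dt}=\frac{\partial H}{\partial p},\quad \frac{dp}{dt}=-\frac{\partial H}{\partial q}.$$ We say that a Hamiltonian system with polynomial Hamiltonian becomes a polynomial Hamiltonian system in new coordinates $(X,Y,Z,W,Q,P)$, which are rational functions of $(t,x,y,z,w,q,p)$, if there is $K\in\mathbb C(t)[X,Y,Z,W,Q,P]$ such that the system, rewritten in the new coordinates, is the Hamiltonian system with Hamiltonian $K$, i.e. $\frac{dX}{dt}=\frac{\partial K}{\partial Y}$, $\frac{dY}{dt}=-\frac{\partial K}{\partial X}$, and likewise for $(Z,W)$ and $(Q,P)$. Assume: (C1) $\deg H=4$ with respect to $x,y,z,w,q,p$.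 (C2) The system becomes a polynomial Hamiltonian system in each of the coordinate systems $r_i$ $(i=0,1,2,4)$: $$\begin{aligned} r_0&:\ x_0=x+\tfrac{2\alpha_0}{y}+\tfrac1{y^2},\ y_0=y,\ z_0=z,\ w_0=w,\ q_0=q,\ p_0=p,\\ r_1&:\ x_1=-((x-z)y-\alpha_1)y,\ y_1=\tfrac1y,\ z_1=z,\ w_1=w+y,\ q_1=q,\ p_1=p,\\ r_2&:\ x_2=x,\ y_2=y,\ z_2=\tfrac1z,\ w_2=-(wz+\alpha_2)z,\ q_2=q,\ p_2=p,\\ r_4&:\ x_4=x,\ y_4=y,\ z_4=z,\ w_4=w,\ q_4=q+\tfrac{2\alpha_4}{p}-\tfrac{t}{p^2},\ p_4=p. \end{aligned}$$ (C3) Moreover, the polynomial Hamiltonian system obtained in the coordinates $(x_2,y_2,z_2,w_2,q_2,p_2)$ becomes again a polynomial Hamiltonian system in the coordinate system $$r_3:\ x_3=x_2,\ y_3=y_2,\ z_3=-((z_2-q_2)w_2-\alpha_3)w_2,\ w_3=\tfrac1{w_2},\ q_3=q_2,\ p_3=p_2+w_2.$$ Then the system is $$\begin{aligned} \frac{dx}{dt}&=\frac{x^2y+z^2w+\alpha_0x+\alpha_2z-p}{t},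 & \frac{dy}{dt}&=\frac{-2xy^2-2\alpha_0y-1}{2t},\\ \frac{dz}{dt}&=\frac{z^2w+yz^2+(\alpha_0+\alpha_1+\alpha_2)z-p}{t}, & \frac{dw}{dt}&=\frac{-zw^2-2yzw-\alpha_2y-(\alpha_0+\alpha_1+\alpha_2)w}{t},\\ \frac{dq}{dt}&=\frac{q^2p-y-w+(\alpha_4-1)q}{t}, & \frac{dp}{dt}&=\frac{-2qp^2-2(\alpha_4-1)p+t}{2t}, \end{aligned}$$ and, up to an additive term in $\mathbb C(t)$ (which does not affect the system), $$H=\frac{x^2y^2+2\alpha_0xy+x}{2t}+\frac{z^2w^2+2(\alpha_0+\alpha_1+\alpha_2)zw}{2t}+\frac{q^2p^2+2(\alpha_4-1)qp-tq}{2t}+\frac{yz(zw+\alpha_2)}{t}-\frac{(y+w)p}{t}.$$ -/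

import Mathlib

/-! The time-dependent Hamiltonian formalism over the field of rational functions `ℂ(t)`, in the six
canonical variables `(x, y, z, w, q, p)`, indexed by `0, …, 5`; the conjugate pairs are
`(x, y)`, `(z, w)`, `(q, p)`. -/

noncomputable section

/-- A derivation of a domain `A` with values in its fraction field `F` extends to `F`
(by the quotient rule, see `fractionDerivation_algebraMap`; such an extension is unique).
It is constructed as the infinitesimal part of the ring homomorphism `F → F[ε]` that extends
`a ↦ a + ε d a`. -/
def fractionHom {k A F : Type*} [CommRing k] [CommRing A] [Field F] [Algebra k A] [Algebra k F]
    [Algebra A F] [IsFractionRing A F] (d : Derivation k A F) : F →+* TrivSqZeroExt F F :=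
  IsLocalization.lift (M := nonZeroDivisors A)
    (g := ({ toFun := fun a => TrivSqZeroExt.inl (algebraMap A F a) + TrivSqZeroExt.inr (d a)
             map_one' := by simp
             map_zero' := by simp
             map_mul' := fun a b => by
               ext
               · simp
               · simp [Algebra.smul_def, TrivSqZeroExt.algebraMap_eq_inl]
                 ring
             map_add' := fun a b => by
               ext <;> simp } : A →+* TrivSqZeroExt F F))
    (fun a => by
      rw [TrivSqZeroExt.isUnit_iff_isUnit_fst]
      simpa using IsLocalization.map_units F a)

theorem fractionHom_algebraMap {k A F : Type*} [CommRing k] [CommRing A] [Field F] [Algebra k A]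
    [Algebra k F] [Algebra A F] [IsFractionRing A F] (d : Derivation k A F) (a : A) :
    fractionHom d (algebraMap A F a)
      = TrivSqZeroExt.inl (algebraMap A F a) + TrivSqZeroExt.inr (d a) := by
  simp [fractionHom]

theorem fst_fractionHom {k A F : Type*} [CommRing k] [CommRing A] [Field F] [Algebra k A]
    [Algebra k F] [Algebra A F] [IsFractionRing A F] (d : Derivation k A F) (f : F) :
    (fractionHom d f).fst = f := by
  have h : ((TrivSqZeroExt.fstHom F F F).toRingHom.comp (fractionHom d)) = RingHom.id F := by
    apply IsLocalization.ringHom_ext (nonZeroDivisors A)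
    ext a
    simp [fractionHom_algebraMap]
  exact congrArg (fun g : F →+* F => g f) h

/-- The extension of a derivation `A → F` to the fraction field `F` of `A`. -/
def fractionDerivation {k A F : Type*} [CommRing k] [CommRing A] [Field F] [Algebra k A]
    [Algebra k F] [Algebra A F] [IsScalarTower k A F] [IsFractionRing A F]
    (d : Derivation k A F) : Derivation k F F :=
  Derivation.mk'
    { toFun := fun f => (fractionHom d f).snd
      map_add' := fun f g => by simp
      map_smul' := fun c f => by
        rw [Algebra.smul_def, map_mul, IsScalarTower.algebraMap_apply k A F,
          fractionHom_algebraMap]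
        simp [← IsScalarTower.algebraMap_apply, Algebra.smul_def] }
    (fun f g => by
      change (fractionHom d (f * g)).snd = f • (fractionHom d g).snd + g • (fractionHom d f).snd
      rw [map_mul, TrivSqZeroExt.snd_mul, fst_fractionHom, fst_fractionHom]
      simp [mul_comm])

theorem fractionDerivation_algebraMap {k A F : Type*} [CommRing k] [CommRing A] [Field F]
    [Algebra k A] [Algebra k F] [Algebra A F] [IsScalarTower k A F] [IsFractionRing A F]
    (d : Derivation k A F) (a : A) : fractionDerivation d (algebraMap A F a) = d a := by
  change (fractionHom d (algebraMap A F a)).snd = d a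
  simp [fractionHom_algebraMap]

/-- The derivation `d/dt` of `ℂ(t)`. -/
def ddt : Derivation ℂ (RatFunc ℂ) (RatFunc ℂ) :=
  fractionDerivation (Polynomial.mkDerivation ℂ (1 : RatFunc ℂ))

/-- `ℂ(t)[x, y, z, w, q, p]`. -/
abbrev PhasePoly : Type := MvPolynomial (Fin 6) (RatFunc ℂ)

/-- `ℂ(t)(x, y, z, w, q, p)`. -/
abbrev PhaseField : Type := FractionRing PhasePoly

/-- Apply `d/dt` to every coefficient of a polynomial. -/
def coeffDdt (a : PhasePoly) : PhasePoly :=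
  ∑ s ∈ a.support, MvPolynomial.monomial s (ddt (a.coeff s))

theorem coeff_coeffDdt (a : PhasePoly) (s : Fin 6 →₀ ℕ) :
    (coeffDdt a).coeff s = ddt (a.coeff s) := by
  classical
  simp only [coeffDdt, MvPolynomial.coeff_sum, MvPolynomial.coeff_monomial, Finset.sum_ite_eq',
    MvPolynomial.mem_support_iff, ne_eq, ite_not]
  split_ifs with h
  · rw [h, map_zero]
  · rfl

/-- The partial derivative `∂/∂t` on `ℂ(t)[x, y, z, w, q, p]`. -/
def partialT : Derivation ℂ PhasePoly PhasePoly :=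
  Derivation.mk'
    { toFun := coeffDdt
      map_add' := fun a b => by
        ext s
        simp [coeff_coeffDdt]
      map_smul' := fun c a => by
        ext s
        simp [coeff_coeffDdt] }
    (fun a b => by
      ext s
      change (coeffDdt (a * b)).coeff s = (a * coeffDdt b + b * coeffDdt a).coeff s
      rw [mul_comm b, coeff_coeffDdt, MvPolynomial.coeff_add, MvPolynomial.coeff_mul,
        MvPolynomial.coeff_mul, MvPolynomial.coeff_mul, map_sum, ← Finset.sum_add_distrib]
      refine Finset.sum_congr rfl fun m _ => ?_
      simp [coeff_coeffDdt, mul_comm])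

/-- The right-hand side of the Hamiltonian system with Hamiltonian `H`:
`dx/dt = ∂H/∂y`, `dy/dt = -∂H/∂x`, `dz/dt = ∂H/∂w`, `dw/dt = -∂H/∂z`, `dq/dt = ∂H/∂p`,
`dp/dt = -∂H/∂q`. -/
def hamiltonianSystem (H : PhasePoly) : Fin 6 → PhasePoly :=
  ![MvPolynomial.pderiv 1 H, -MvPolynomial.pderiv 0 H,
    MvPolynomial.pderiv 3 H, -MvPolynomial.pderiv 2 H,
    MvPolynomial.pderiv 5 H, -MvPolynomial.pderiv 4 H]

/-- The total time derivative of rational functions of `(t, x, y, z, w, q, p)` along the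
Hamiltonian system of `H`: `D f = ∂f/∂t + (dx/dt) ∂f/∂x + ⋯ + (dp/dt) ∂f/∂p`
(`mkDerivation v` is the derivation `∑ i, v i ∂/∂xᵢ`). -/
def totalDeriv (H : PhasePoly) : Derivation ℂ PhaseField PhaseField :=
  fractionDerivation ((Algebra.linearMap PhasePoly PhaseField).compDer
    (partialT +
      (MvPolynomial.mkDerivation (RatFunc ℂ) (hamiltonianSystem H)).restrictScalars ℂ))

/-- The Hamiltonian system of `H`, written in the new coordinates `r` (six rational functions of
`(t, x, y, z, w, q, p)`), is the Hamiltonian system of the polynomial `K` in these coordinates: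
`d r₀/dt = (∂K/∂y)(r)`, `d r₁/dt = -(∂K/∂x)(r)`, and so on. -/
def BecomesSystemOf (H : PhasePoly) (r : Fin 6 → PhaseField) (K : PhasePoly) : Prop :=
  ∀ i, totalDeriv H (r i) = MvPolynomial.aeval r (hamiltonianSystem K i)

/-- The coordinate functions `x, y, z, w, q, p` as elements of `ℂ(t)(x, y, z, w, q, p)`. -/
def crd (i : Fin 6) : PhaseField := algebraMap PhasePoly PhaseField (MvPolynomial.X i)

/-- A complex constant as an element of `ℂ(t)(x, y, z, w, q, p)`. -/
def cst (c : ℂ) : PhaseField := algebraMap ℂ PhaseField c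

/-- The independent variable `t` as an element of `ℂ(t)(x, y, z, w, q, p)`. -/
def timeF : PhaseField := algebraMap (RatFunc ℂ) PhaseField RatFunc.X

/-- `(x + 2α₀/y + 1/y², y, z, w, q, p)` -/
def chart0 (α : Fin 5 → ℂ) : Fin 6 → PhaseField :=
  ![crd 0 + 2 * cst (α 0) / crd 1 + 1 / crd 1 ^ 2, crd 1, crd 2, crd 3, crd 4, crd 5]

/-- `(-((x - z)y - α₁)y, 1/y, z, w + y, q, p)` -/
def chart1 (α : Fin 5 → ℂ) : Fin 6 → PhaseField :=
  ![-((crd 0 - crd 2) * crd 1 - cst (α 1)) * crd 1, 1 / crd 1, crd 2, crd 3 + crd 1,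
    crd 4, crd 5]

/-- `(x, y, 1/z, -(wz + α₂)z, q, p)` -/
def chart2 (α : Fin 5 → ℂ) : Fin 6 → PhaseField :=
  ![crd 0, crd 1, 1 / crd 2, -(crd 3 * crd 2 + cst (α 2)) * crd 2, crd 4, crd 5]

/-- `(x, y, -((z - q)w - α₃)w, 1/w, q, p + w)` -/
def chart3 (α : Fin 5 → ℂ) : Fin 6 → PhaseField :=
  ![crd 0, crd 1, -((crd 2 - crd 4) * crd 3 - cst (α 3)) * crd 3, 1 / crd 3, crd 4,
    crd 5 + crd 3]

/-- `(x, y, z, w, q + 2α₄/p - t/p², p)` -/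
def chart4 (α : Fin 5 → ℂ) : Fin 6 → PhaseField :=
  ![crd 0, crd 1, crd 2, crd 3, crd 4 + 2 * cst (α 4) / crd 5 - timeF / crd 5 ^ 2, crd 5]

/-- A complex constant as an element of `ℂ(t)[x, y, z, w, q, p]`. -/
def cstP (c : ℂ) : PhasePoly := algebraMap ℂ PhasePoly c

/-- The independent variable `t` as an element of `ℂ(t)[x, y, z, w, q, p]`. -/
def timeP : PhasePoly := MvPolynomial.C RatFunc.X

/-- `1/t` as an element of `ℂ(t)[x, y, z, w, q, p]`. -/
def invTime : PhasePoly := MvPolynomial.C (1 / RatFunc.X)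

/-- `1/(2t)` as an element of `ℂ(t)[x, y, z, w, q, p]`. -/
def invTwoTime : PhasePoly := MvPolynomial.C (1 / (2 * RatFunc.X))

/-- The polynomial Hamiltonian of the coupled system of type `D₅⁽²⁾`. -/
def hamD52 (α : Fin 5 → ℂ) : PhasePoly :=
  let x : PhasePoly := MvPolynomial.X 0
  let y : PhasePoly := MvPolynomial.X 1
  let z : PhasePoly := MvPolynomial.X 2
  let w : PhasePoly := MvPolynomial.X 3
  let q : PhasePoly := MvPolynomial.X 4
  let p : PhasePoly := MvPolynomial.X 5
  invTwoTime * (x ^ 2 * y ^ 2 + 2 * cstP (α 0) * x * y + x)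
    + invTwoTime * (z ^ 2 * w ^ 2 + 2 * cstP (α 0 + α 1 + α 2) * z * w)
    + invTwoTime * (q ^ 2 * p ^ 2 + 2 * cstP (α 4 - 1) * q * p - timeP * q)
    + invTime * (y * z * (z * w + cstP (α 2)))
    - invTime * ((y + w) * p)

/-- The right-hand sides `(dx/dt, dy/dt, dz/dt, dw/dt, dq/dt, dp/dt)` of the coupled system of type
`D₅⁽²⁾`. -/
def systemD52 (α : Fin 5 → ℂ) : Fin 6 → PhasePoly :=
  let x : PhasePoly := MvPolynomial.X 0
  let y : PhasePoly := MvPolynomial.X 1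
  let z : PhasePoly := MvPolynomial.X 2
  let w : PhasePoly := MvPolynomial.X 3
  let q : PhasePoly := MvPolynomial.X 4
  let p : PhasePoly := MvPolynomial.X 5
  ![invTime * (x ^ 2 * y + z ^ 2 * w + cstP (α 0) * x + cstP (α 2) * z - p),
    invTwoTime * (-2 * x * y ^ 2 - 2 * cstP (α 0) * y - 1),
    invTime * (z ^ 2 * w + y * z ^ 2 + cstP (α 0 + α 1 + α 2) * z - p),
    invTime * (-(z * w ^ 2) - 2 * y * z * w - cstP (α 2) * y - cstP (α 0 + α 1 + α 2) * w),
    invTime * (q ^ 2 * p - y - w + cstP (α 4 - 1) * q),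
    invTwoTime * (-2 * q * p ^ 2 - 2 * cstP (α 4 - 1) * p + timeP)]

end

/-! Every chart is a canonical transformation in the phase variables. By the chain rule the
transformed Hamiltonian satisfies K(r) = H + c with c in ℂ(t). Only r₄ depends explicitly on t, and
there 1/p is added, because ∂q₄/∂t = -1/p². This rests on the fact that a rational function with
vanishing partial derivatives lies in ℂ(t) (`exists_eq_algebraMap_of_partialF_eq_zero`).

So the hypotheses become statements about poles. Choose a point whose new coordinates lie in R[τ],
while its old coordinates have poles at τ = 0. Then K is regular there, so H is too, and every polar
coefficient of H vanishes. A polynomial in 1/τ that lies in R[τ] is constant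
(`coeff_eq_zero_of_aeval_inv_mem`); `aeval_eq_of_specialization` makes K(r) = H + c available at
such points.

The charts r₀, r₂, r₄ each involve only one conjugate pair, so they give linear relations between
coefficients in that pair for each monomial in the other four variables. With degree at most four,
only finitely many monomials remain besides a polynomial P(y, w, p) and a term zw N(y, w, p)
(`exists_shape_of_charts₀₂₄`).

The chart r₁ mixes the pairs through w + y. Letting y tend to infinity with W = w + y fixed
determines N and leaves of P only a known term and an unknown μ(y + w, p)
(`exists_shape_of_charts₀₁₂₄`). The composite of r₂ and r₃ then fixes the form of μ and kills the
surplus constants. It leaves one factor A with 2A(α₀ + α₁ + α₂ + α₃ + α₄) = 1/t, so the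
normalization of the parameters gives A = 1/(2t). -/

noncomputable section

/-! ### Canonical charts preserve the Hamiltonian up to explicit corrections -/

/-- The partial derivative `∂/∂xⱼ` on `ℂ(t)(x, y, z, w, q, p)`. -/
def partialF (j : Fin 6) : Derivation (RatFunc ℂ) PhaseField PhaseField :=
  fractionDerivation ((Algebra.linearMap PhasePoly PhaseField).compDer (MvPolynomial.pderiv j))

theorem partialF_algebraMap (j : Fin 6) (f : PhasePoly) :
    partialF j (algebraMap PhasePoly PhaseField f)
      = algebraMap PhasePoly PhaseField (MvPolynomial.pderiv j f) := by
  simp [partialF, fractionDerivation_algebraMap]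

theorem partialF_crd (j i : Fin 6) : partialF j (crd i) = if i = j then 1 else 0 := by
  rw [crd, partialF_algebraMap, MvPolynomial.pderiv_X]
  by_cases h : i = j
  · subst h; simp
  · simp [h]

theorem cst_eq (c : ℂ) : cst c = algebraMap (RatFunc ℂ) PhaseField (algebraMap ℂ (RatFunc ℂ) c) :=
  IsScalarTower.algebraMap_apply ℂ (RatFunc ℂ) PhaseField c

theorem partialF_cst (j : Fin 6) (c : ℂ) : partialF j (cst c) = 0 := by
  rw [cst_eq, Derivation.map_algebraMap]

theorem partialF_timeF (j : Fin 6) : partialF j timeF = 0 := by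
  rw [timeF, Derivation.map_algebraMap]

theorem derivation_aeval {k F : Type*} {σ : Type*} [Fintype σ] [Field k] [Field F] [Algebra k F]
    (D : Derivation k F F)
    (r : σ → F) (K : MvPolynomial σ k) :
    D (MvPolynomial.aeval r K)
      = ∑ i, MvPolynomial.aeval r (MvPolynomial.pderiv i K) * D (r i) := by
  classical
  induction K using MvPolynomial.induction_on with
  | C a => simp 
  | add f g hf hg => simp [hf, hg, add_mul, Finset.sum_add_distrib]
  | mul_X f i hf =>
    simp only [map_mul, MvPolynomial.aeval_X, Derivation.leibniz, hf, smul_eq_mul, map_add,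
      MvPolynomial.pderiv_X, add_mul, Finset.sum_add_distrib]
    congr 1
    · rw [Finset.sum_eq_single i]
      · simp
      · intro b _ hb
        simp [Ne.symm hb]
      · simp
    · rw [Finset.mul_sum]
      exact Finset.sum_congr rfl fun _ _ => by ring

theorem totalDeriv_algebraMap (H f : PhasePoly) :
    totalDeriv H (algebraMap PhasePoly PhaseField f)
      = algebraMap PhasePoly PhaseField
        (partialT f + MvPolynomial.mkDerivation (RatFunc ℂ) (hamiltonianSystem H) f) := by
  simp [totalDeriv, fractionDerivation_algebraMap]

theorem coeffDdt_C (c : RatFunc ℂ) : coeffDdt (MvPolynomial.C c) = MvPolynomial.C (ddt c) := by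
  classical
  ext s
  rw [coeff_coeffDdt, MvPolynomial.coeff_C, MvPolynomial.coeff_C]
  split_ifs <;> simp

theorem partialT_X (i : Fin 6) : partialT (MvPolynomial.X i) = 0 := by
  classical
  change coeffDdt (MvPolynomial.X i) = 0
  ext s
  rw [coeff_coeffDdt, MvPolynomial.coeff_X]
  split_ifs <;> simp

theorem totalDeriv_crd (H : PhasePoly) (i : Fin 6) :
    totalDeriv H (crd i) = algebraMap PhasePoly PhaseField (hamiltonianSystem H i) := by
  rw [crd, totalDeriv_algebraMap, partialT_X, MvPolynomial.mkDerivation_X, zero_add]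

theorem totalDeriv_cst (H : PhasePoly) (c : ℂ) : totalDeriv H (cst c) = 0 :=
  Derivation.map_algebraMap _ _

theorem ddt_X : ddt RatFunc.X = 1 := by
  rw [← RatFunc.algebraMap_X, ddt, fractionDerivation_algebraMap, Polynomial.mkDerivation_X]

theorem totalDeriv_timeF (H : PhasePoly) : totalDeriv H timeF = 1 := by
  have h : timeF = algebraMap PhasePoly PhaseField (MvPolynomial.C RatFunc.X) := by
    rw [timeF, IsScalarTower.algebraMap_apply (RatFunc ℂ) PhasePoly PhaseField]; rfl
  rw [h, totalDeriv_algebraMap]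
  have h2 : partialT (MvPolynomial.C RatFunc.X) = 1 := by
    change coeffDdt _ = 1
    rw [coeffDdt_C, ddt_X, map_one]
  rw [h2, ← MvPolynomial.algebraMap_eq, Derivation.map_algebraMap]
  simp

theorem totalDegree_pderiv_lt {b : PhasePoly} {j : Fin 6} (h : MvPolynomial.pderiv j b ≠ 0) :
    (MvPolynomial.pderiv j b).totalDegree < b.totalDegree := by
  obtain ⟨s, hs, hd⟩ := Finset.exists_mem_eq_sup (MvPolynomial.pderiv j b).support
    (MvPolynomial.support_nonempty.mpr h) (fun s => s.sum fun _ e => e)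
  have hs' : s + Finsupp.single j 1 ∈ b.support := by
    rw [MvPolynomial.mem_support_iff] at hs ⊢
    intro h0
    rw [MvPolynomial.coeff_pderiv, h0, zero_mul] at hs
    exact hs rfl
  have := MvPolynomial.le_totalDegree hs'
  rw [Finsupp.sum_add_index' (fun _ => rfl) (fun _ _ _ => rfl),
    Finsupp.sum_single_index rfl] at this
  change (MvPolynomial.pderiv j b).support.sup _ < _
  omega

/-- Differentiation lowers the total degree, so a nonzero derivative cannot be a multiple of `b`. -/
theorem pderiv_eq_zero_of_dvd {b : PhasePoly} {j : Fin 6} (h : b ∣ MvPolynomial.pderiv j b) :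
    MvPolynomial.pderiv j b = 0 := by
  by_contra hne
  obtain ⟨c, hc⟩ := h
  have hb : b ≠ 0 := by rintro rfl; simp at hne
  have hc0 : c ≠ 0 := by rintro rfl; simp at hc; exact hne hc
  have := totalDegree_pderiv_lt hne
  rw [hc, MvPolynomial.totalDegree_mul_of_isDomain hb hc0] at this
  omega

theorem eq_C_of_pderiv_eq_zero {b : PhasePoly} (h : ∀ j, MvPolynomial.pderiv j b = 0) :
    b = MvPolynomial.C (b.coeff 0) := by
  classical
  ext s
  rw [MvPolynomial.coeff_C]
  split_ifs with hs
  · rw [hs]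
  · obtain ⟨j, hj⟩ : ∃ j, s j ≠ 0 := by
      by_contra! h0
      exact hs (Finsupp.ext fun j => (h0 j).symm)
    have hle : Finsupp.single j 1 ≤ s := by
      rw [Finsupp.single_le_iff]; omega
    have h1 := MvPolynomial.coeff_pderiv (i := j) b (s - Finsupp.single j 1)
    rw [h j, tsub_add_cancel_of_le hle, MvPolynomial.coeff_zero, eq_comm, mul_eq_zero] at h1
    exact h1.resolve_right (Nat.cast_add_one_ne_zero _)

/-- Write f = a/b in lowest terms. Differentiating fb = a gives a ∂b = b ∂a, so b divides ∂b by
coprimality. Hence every ∂b vanishes, then every ∂a, and in characteristic zero a and b are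
constants. -/
theorem exists_eq_algebraMap_of_partialF_eq_zero {f : PhaseField} (h : ∀ j, partialF j f = 0) :
    ∃ c : RatFunc ℂ, f = algebraMap PhasePoly PhaseField (MvPolynomial.C c) := by
  obtain ⟨a, b, hab, hf⟩ := IsFractionRing.exists_reduced_fraction (A := PhasePoly) f
  have hb0 : (b : PhasePoly) ≠ 0 := nonZeroDivisors.coe_ne_zero b
  have hf' : f * algebraMap PhasePoly PhaseField b = algebraMap PhasePoly PhaseField a := by
    rw [← hf, IsLocalization.mk'_spec]
  have hd : ∀ j, a * MvPolynomial.pderiv j (b : PhasePoly)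
      = b * MvPolynomial.pderiv j a := by
    intro j
    apply IsFractionRing.injective PhasePoly PhaseField
    have h1 := congrArg (partialF j) hf'
    rw [Derivation.leibniz, h j, partialF_algebraMap, partialF_algebraMap, smul_zero, add_zero,
      smul_eq_mul] at h1
    rw [map_mul, map_mul, ← h1, ← hf']
    ring
  have hb : ∀ j, MvPolynomial.pderiv j (b : PhasePoly) = 0 := fun j =>
    pderiv_eq_zero_of_dvd (hab.symm.dvd_of_dvd_mul_left ⟨_, hd j⟩)
  have ha : ∀ j, MvPolynomial.pderiv j a = 0 := by
    intro j
    have := hd j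
    rw [hb j, mul_zero, eq_comm, mul_eq_zero] at this
    exact this.resolve_left hb0
  rw [eq_C_of_pderiv_eq_zero ha, eq_C_of_pderiv_eq_zero hb] at hf'
  have hc : (b : PhasePoly).coeff 0 ≠ 0 := by
    intro h0
    apply hb0
    rw [eq_C_of_pderiv_eq_zero hb, h0, map_zero]
  refine ⟨a.coeff 0 / (b : PhasePoly).coeff 0, ?_⟩
  have hc' : algebraMap PhasePoly PhaseField (MvPolynomial.C ((b : PhasePoly).coeff 0)) ≠ 0 := by
    rw [Ne, map_eq_zero_iff _ (IsFractionRing.injective PhasePoly PhaseField)]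
    simpa using hc
  apply mul_right_cancel₀ hc'
  rw [hf', ← map_mul, ← map_mul, div_mul_cancel₀ _ hc]

/-- If `K(r)` and `f` have the same partial derivatives, they differ by an element of `ℂ(t)`. -/
theorem exists_aeval_eq {K : PhasePoly} {r : Fin 6 → PhaseField} {f : PhaseField}
    (h : ∀ j, ∑ i, MvPolynomial.aeval r (MvPolynomial.pderiv i K) * partialF j (r i)
      = partialF j f) :
    ∃ c : RatFunc ℂ, MvPolynomial.aeval r K
      = f + algebraMap PhasePoly PhaseField (MvPolynomial.C c) := by
  obtain ⟨c, hc⟩ := exists_eq_algebraMap_of_partialF_eq_zero (f := MvPolynomial.aeval r K - f)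
    (fun j => by rw [map_sub, derivation_aeval, h j, sub_self])
  exact ⟨c, by rw [← hc]; ring⟩

theorem crd_ne_zero (i : Fin 6) : crd i ≠ 0 := by
  rw [crd, Ne, map_eq_zero_iff _ (IsFractionRing.injective PhasePoly PhaseField)]
  exact MvPolynomial.X_ne_zero i

/-- The gradient of `K` at the new coordinates, read off from the transformed system. -/
theorem BecomesSystemOf.gradient {H K : PhasePoly} {r : Fin 6 → PhaseField}
    (h : BecomesSystemOf H r K) (i : Fin 6) :
    MvPolynomial.aeval r (MvPolynomial.pderiv i K)
      = ![-totalDeriv H (r 1), totalDeriv H (r 0), -totalDeriv H (r 3), totalDeriv H (r 2),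
          -totalDeriv H (r 5), totalDeriv H (r 4)] i := by
  have h0 := h 0
  have h1 := h 1
  have h2 := h 2
  have h3 := h 3
  have h4 := h 4
  have h5 := h 5
  fin_cases i <;> simp_all [hamiltonianSystem]

theorem derivation_two {k F : Type*} [Field k] [Field F] [Algebra k F] (D : Derivation k F F) :
    D 2 = 0 :=
  D.map_natCast 2

/-- The gradient of `K` at the new coordinates is a rotated velocity of the chart along the flow.
Because the Jacobian is symplectic and t does not occur explicitly, contracting it with the Jacobian
returns exactly the gradient of `H`. The same holds for r₁, r₂ and r₃. -/
theorem BecomesSystemOf.exists_chart0 {α : Fin 5 → ℂ} {H K : PhasePoly}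
    (h : BecomesSystemOf H (chart0 α) K) :
    ∃ c : RatFunc ℂ, MvPolynomial.aeval (chart0 α) K
      = algebraMap PhasePoly PhaseField (H + MvPolynomial.C c) := by
  have hy := crd_ne_zero 1
  simp only [map_add]
  apply exists_aeval_eq
  intro j
  rw [Fin.sum_univ_six]
  simp only [h.gradient, partialF_algebraMap]
  fin_cases j <;>
    simp [chart0, partialF_crd, partialF_cst, totalDeriv_crd, totalDeriv_cst, derivation_two,
      Derivation.leibniz_div, Derivation.leibniz, Derivation.leibniz_inv,
      hamiltonianSystem, -inv_pow]
  all_goals try field_simp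
  all_goals try ring

theorem BecomesSystemOf.exists_chart1 {α : Fin 5 → ℂ} {H K : PhasePoly}
    (h : BecomesSystemOf H (chart1 α) K) :
    ∃ c : RatFunc ℂ, MvPolynomial.aeval (chart1 α) K
      = algebraMap PhasePoly PhaseField (H + MvPolynomial.C c) := by
  have hy := crd_ne_zero 1
  simp only [map_add]
  apply exists_aeval_eq
  intro j
  rw [Fin.sum_univ_six]
  simp only [h.gradient, partialF_algebraMap]
  fin_cases j <;>
    simp [chart1, partialF_crd, partialF_cst, totalDeriv_crd, totalDeriv_cst,
      Derivation.leibniz, Derivation.leibniz_inv,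
      hamiltonianSystem, -inv_pow]
  all_goals try field_simp
  all_goals try ring

theorem BecomesSystemOf.exists_chart2 {α : Fin 5 → ℂ} {H K : PhasePoly}
    (h : BecomesSystemOf H (chart2 α) K) :
    ∃ c : RatFunc ℂ, MvPolynomial.aeval (chart2 α) K
      = algebraMap PhasePoly PhaseField (H + MvPolynomial.C c) := by
  have hy := crd_ne_zero 2
  simp only [map_add]
  apply exists_aeval_eq
  intro j
  rw [Fin.sum_univ_six]
  simp only [h.gradient, partialF_algebraMap]
  fin_cases j <;>
    simp [chart2, partialF_crd, partialF_cst, totalDeriv_crd, totalDeriv_cst,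
      Derivation.leibniz, Derivation.leibniz_inv,
      hamiltonianSystem, -inv_pow]
  all_goals try field_simp
  all_goals try ring

theorem BecomesSystemOf.exists_chart3 {α : Fin 5 → ℂ} {H K : PhasePoly}
    (h : BecomesSystemOf H (chart3 α) K) :
    ∃ c : RatFunc ℂ, MvPolynomial.aeval (chart3 α) K
      = algebraMap PhasePoly PhaseField (H + MvPolynomial.C c) := by
  have hy := crd_ne_zero 3
  simp only [map_add]
  apply exists_aeval_eq
  intro j
  rw [Fin.sum_univ_six]
  simp only [h.gradient, partialF_algebraMap]
  fin_cases j <;>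
    simp [chart3, partialF_crd, partialF_cst, totalDeriv_crd, totalDeriv_cst,
      Derivation.leibniz, Derivation.leibniz_inv,
      hamiltonianSystem, -inv_pow]
  all_goals try field_simp
  all_goals try ring

/-- The explicit time derivative -1/p² of the new q is the p-derivative of 1/p, which is the
correction term. -/
theorem BecomesSystemOf.exists_chart4 {α : Fin 5 → ℂ} {H K : PhasePoly}
    (h : BecomesSystemOf H (chart4 α) K) :
    ∃ c : RatFunc ℂ, MvPolynomial.aeval (chart4 α) K
      = algebraMap PhasePoly PhaseField (H + MvPolynomial.C c) + 1 / crd 5 := by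
  have hy := crd_ne_zero 5
  suffices ∃ c : RatFunc ℂ, MvPolynomial.aeval (chart4 α) K
      = (algebraMap PhasePoly PhaseField H + 1 / crd 5)
        + algebraMap PhasePoly PhaseField (MvPolynomial.C c) by
    obtain ⟨c, hc⟩ := this
    exact ⟨c, by rw [hc, map_add]; ring⟩
  apply exists_aeval_eq
  intro j
  rw [Fin.sum_univ_six]
  simp only [h.gradient, map_add, partialF_algebraMap]
  fin_cases j <;>
    simp [chart4, partialF_crd, partialF_cst, partialF_timeF, totalDeriv_crd, totalDeriv_cst,
      totalDeriv_timeF, derivation_two,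
      Derivation.leibniz_div, Derivation.leibniz, Derivation.leibniz_inv,
      hamiltonianSystem, -inv_pow]
  all_goals try field_simp
  all_goals try ring

/-! ### Specializing identities of rational functions -/

/-- A relation `K(r) = G` between rational functions may be specialized along a homomorphism that
inverts the denominators of `r`. -/
theorem aeval_eq_of_specialization {S : Type*} [CommRing S] [Nontrivial S] [Algebra (RatFunc ℂ) S]
    (ψ : PhasePoly →ₐ[RatFunc ℂ] S) {K G : PhasePoly} {r : Fin 6 → PhaseField}
    (a b : Fin 6 → PhasePoly) (v : Fin 6 → S)
    (hb : ∀ i, IsUnit (ψ (b i)))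
    (hr : ∀ i, r i * algebraMap PhasePoly PhaseField (b i)
      = algebraMap PhasePoly PhaseField (a i))
    (hv : ∀ i, v i * ψ (b i) = ψ (a i))
    (h : MvPolynomial.aeval r K = algebraMap PhasePoly PhaseField G) :
    MvPolynomial.aeval v K = ψ G := by
  -- The elements that `ψ` inverts are nonzero since `S` is nontrivial. Localizing at them gives a
  -- ring that embeds in `PhaseField`, where the relation is known, and also maps to `S`, where it
  -- is wanted.
  let M : Submonoid PhasePoly := (IsUnit.submonoid S).comap ψ
  have hM : M ≤ nonZeroDivisors PhasePoly := by
    intro m hm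
    apply mem_nonZeroDivisors_of_ne_zero
    rintro rfl
    have : IsUnit (ψ 0) := hm
    simp at this
  let φ : Localization M →ₐ[RatFunc ℂ] S :=
    IsLocalization.liftAlgHom (M := M) (f := ψ) (fun y => y.2)
  let ι : Localization M →ₐ[RatFunc ℂ] PhaseField :=
    IsLocalization.liftAlgHom (M := M) (f := Algebra.algHom (RatFunc ℂ) PhasePoly PhaseField)
      (fun y => IsLocalization.map_units PhaseField ⟨y.1, hM y.2⟩)
  have hφ : ∀ p, φ (algebraMap _ _ p) = ψ p := fun p => IsLocalization.lift_eq _ p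
  have hι' : ∀ p, ι (algebraMap _ _ p) = algebraMap PhasePoly PhaseField p := fun p =>
    IsLocalization.lift_eq _ p
  have hι : Function.Injective ι := by
    refine IsLocalization.injective_of_map_algebraMap_zero (M := M) _ (ι : Localization M →+* PhaseField) fun p hp => ?_
    change ι (algebraMap _ _ p) = 0 at hp
    rw [hι', map_eq_zero_iff _ (IsFractionRing.injective PhasePoly PhaseField)] at hp
    rw [hp, map_zero]
  let u : Fin 6 → Localization M := fun i => IsLocalization.mk' _ (a i) (⟨b i, hb i⟩ : M)
  have hu : ∀ i, u i * algebraMap PhasePoly _ (b i) = algebraMap PhasePoly _ (a i) := fun i =>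
    IsLocalization.mk'_spec _ (a i) (⟨b i, hb i⟩ : M)
  have hιu : ∀ i, ι (u i) = r i := by
    intro i
    have h1 := congrArg ι (hu i)
    rw [map_mul, hι', hι', ← hr i] at h1
    exact mul_right_cancel₀ (IsFractionRing.to_map_ne_zero_of_mem_nonZeroDivisors (hM (hb i))) h1
  have hφu : ∀ i, φ (u i) = v i := by
    intro i
    have h1 := congrArg φ (hu i)
    rw [map_mul, hφ, hφ, ← hv i] at h1
    exact (hb i).mul_right_cancel h1
  have key : MvPolynomial.aeval u K = algebraMap PhasePoly _ G := by
    apply hι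
    rw [hι', ← h, MvPolynomial.comp_aeval_apply]
    congr 2
    exact funext hιu
  have h2 := congrArg φ key
  rw [hφ, MvPolynomial.comp_aeval_apply] at h2
  rw [← h2]
  congr 2
  exact (funext hφu).symm

/-! ### Poles in an auxiliary parameter τ -/

/-- `R(τ)`. -/
abbrev RatF (R : Type*) [CommRing R] : Type _ := FractionRing (Polynomial R)

/-- The indeterminate `τ` of `R(τ)`. -/
def tau (R : Type*) [CommRing R] : RatF R := algebraMap (Polynomial R) (RatF R) Polynomial.X

/-- The subalgebra `R[τ]` of `R(τ)`. -/
def regular (R : Type*) [CommRing R] [Algebra (RatFunc ℂ) R] : Subalgebra (RatFunc ℂ) (RatF R) :=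
  (Algebra.algHom (RatFunc ℂ) (Polynomial R) (RatF R)).range

section regular

variable {R : Type*} [CommRing R]

theorem tau_ne_zero [IsDomain R] : tau R ≠ 0 := by
  rw [tau, Ne, map_eq_zero_iff _ (IsFractionRing.injective _ _)]
  exact Polynomial.X_ne_zero

variable [Algebra (RatFunc ℂ) R]

theorem tau_mem : tau R ∈ regular R := ⟨Polynomial.X, rfl⟩

theorem algebraMap_mem_regular (r : R) : algebraMap R (RatF R) r ∈ regular R :=
  ⟨Polynomial.C r, by
    rw [IsScalarTower.algebraMap_apply R (Polynomial R) (RatF R)]; rfl⟩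

variable [IsDomain R]

/-- A polynomial in `τ⁻¹` that is regular at `τ = 0` is constant. -/
theorem coeff_eq_zero_of_aeval_inv_mem {f : Polynomial R}
    (h : Polynomial.aeval (tau R)⁻¹ f ∈ regular R) {n : ℕ} (hn : n ≠ 0) : f.coeff n = 0 := by
  obtain ⟨g, hg⟩ := h
  change algebraMap (Polynomial R) (RatF R) g = _ at hg
  have hτ := tau_ne_zero (R := R)
  let _ : Invertible (tau R)⁻¹ := invertibleOfNonzero (inv_ne_zero hτ)
  -- If f(1/τ) = g(τ) and d is the degree of f, then reverse f = g·X^d. All coefficients of reverse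
  -- f below d vanish, and these are the nonconstant coefficients of f.
  have h1 := Polynomial.eval₂_reverse_mul_pow (algebraMap R (RatF R)) (tau R)⁻¹ f
  rw [invOf_eq_inv, inv_inv, ← Polynomial.aeval_def, ← Polynomial.aeval_def, ← hg, tau,
    Polynomial.aeval_algebraMap_apply, Polynomial.aeval_X_left_apply, inv_pow,
    mul_inv_eq_iff_eq_mul₀ (by rw [← tau]; exact pow_ne_zero _ hτ), ← map_pow, ← map_mul] at h1
  have h2 := IsFractionRing.injective _ _ h1
  by_cases hlt : f.natDegree < n
  · exact Polynomial.coeff_eq_zero_of_natDegree_lt hlt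
  have h3 := Polynomial.coeff_reverse f (f.natDegree - n)
  rw [Polynomial.revAt_le (Nat.sub_le _ _), Nat.sub_sub_self (not_lt.mp hlt), h2,
    Polynomial.coeff_mul_X_pow', if_neg (by omega)] at h3
  exact h3.symm

/-- The working form of the pole argument: a vector lists the polar coefficients. Entry `i` belongs
to τ^(-(i+1)), the shift leaving out the unconstrained constant term. -/
theorem eq_zero_of_sum_inv_mem {N : ℕ} {e : Fin N → R}
    (h : ∑ i, algebraMap R (RatF R) (e i) * (tau R)⁻¹ ^ (i.1 + 1) ∈ regular R) (i : Fin N) :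
    e i = 0 := by
  have h1 : Polynomial.aeval (tau R)⁻¹
      (∑ i : Fin N, Polynomial.C (e i) * Polynomial.X ^ (i.1 + 1)) ∈ regular R := by
    simpa using h
  have h2 := coeff_eq_zero_of_aeval_inv_mem h1 (Nat.succ_ne_zero i.1)
  rw [Polynomial.finsetSum_coeff, Finset.sum_eq_single i] at h2
  · simpa using h2
  · intro j _ hj
    have : i.1 ≠ j.1 := fun h => hj (Fin.ext h.symm)
    simp [Polynomial.coeff_X_pow, this]
  · simp

end regular

/-- Polynomials all of whose coefficients lie in a subalgebra. -/
def coeffSubalgebra {k L : Type*} (σ : Type*) [CommRing k] [CommRing L] [Algebra k L]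
    (B : Subalgebra k L) : Subalgebra k (MvPolynomial σ L) where
  carrier := {f | ∀ s, f.coeff s ∈ B}
  mul_mem' {a b} ha hb s := by
    classical
    rw [MvPolynomial.coeff_mul]
    exact B.sum_mem fun x _ => B.mul_mem (ha _) (hb _)
  add_mem' {a b} ha hb s := by
    rw [MvPolynomial.coeff_add]
    exact B.add_mem (ha s) (hb s)
  algebraMap_mem' r s := by
    classical
    rw [IsScalarTower.algebraMap_apply k L (MvPolynomial σ L), MvPolynomial.algebraMap_eq,
      MvPolynomial.coeff_C]
    split_ifs
    · exact B.algebraMap_mem r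
    · exact B.zero_mem

theorem C_mem_coeffSubalgebra {k L σ : Type*} [CommRing k] [CommRing L] [Algebra k L]
    {B : Subalgebra k L} {c : L} (hc : c ∈ B) : MvPolynomial.C c ∈ coeffSubalgebra σ B := by
  classical
  intro s
  rw [MvPolynomial.coeff_C]
  split_ifs
  · exact hc
  · exact B.zero_mem

theorem X_mem_coeffSubalgebra {k L σ : Type*} [CommRing k] [CommRing L] [Algebra k L]
    {B : Subalgebra k L} (i : σ) : MvPolynomial.X i ∈ coeffSubalgebra σ B := by
  classical
  intro s
  rw [MvPolynomial.coeff_X]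
  split_ifs
  · exact B.one_mem
  · exact B.zero_mem

theorem aeval_mem_subalgebra {k S σ : Type*} [CommRing k] [CommRing S] [Algebra k S]
    {B : Subalgebra k S} {v : σ → S} (hv : ∀ i, v i ∈ B) (K : MvPolynomial σ k) :
    MvPolynomial.aeval v K ∈ B := by
  induction K using MvPolynomial.induction_on with
  | C a => simp
  | add f g hf hg => simpa using B.add_mem hf hg
  | mul_X f i hf => simpa using B.mul_mem hf (hv i)

/-- Substitution of scalars `U`, `V` of an extension `L` for the variables `a`, `b`. -/
def pairValue {L : Type*} [CommRing L] (a b : Fin 6) (U V : L) (i : Fin 6) :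
    MvPolynomial (Fin 6) L :=
  if i = a then MvPolynomial.C U else if i = b then MvPolynomial.C V else MvPolynomial.X i

theorem aeval_pairValue_monomial {k L : Type*} [Field k] [CommRing L] [Algebra k L]
    {a b : Fin 6} (hab : a ≠ b) (U V : L) (s : Fin 6 →₀ ℕ) (c : k) :
    MvPolynomial.aeval (pairValue a b U V) (MvPolynomial.monomial s c)
      = MvPolynomial.monomial ((s.erase a).erase b) (algebraMap k L c * U ^ s a * V ^ s b) := by
  rw [MvPolynomial.aeval_monomial, MvPolynomial.monomial_eq, Finsupp.prod_fintype _ _ (by simp),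
    Finsupp.prod_fintype _ _ (by simp)]
  rw [IsScalarTower.algebraMap_apply k L (MvPolynomial (Fin 6) L), MvPolynomial.algebraMap_eq,
    map_mul, map_mul, mul_assoc, mul_assoc]
  congr 1
  have h : ∀ i : Fin 6, pairValue a b U V i ^ s i = (if i = a then MvPolynomial.C (U ^ s a) else 1) *
      ((if i = b then MvPolynomial.C (V ^ s b) else 1) *
      MvPolynomial.X i ^ ((s.erase a).erase b) i) := by
    intro i
    by_cases ha : i = a
    · subst ha
      simp [pairValue, hab]
    · by_cases hb : i = b
      · subst hb
        simp [pairValue, ha]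
      · simp [pairValue, ha, hb, Finsupp.erase_ne]
  rw [Finset.prod_congr rfl fun i _ => h i, Finset.prod_mul_distrib, Finset.prod_mul_distrib]
  simp

/-- The four variables not substituted stay indeterminates, so regularity can be tested at each
monomial `s` in them separately. Degree at most four makes exponents below 5 sufficient. -/
theorem sum_coeff_mem_of_aeval_pairValue_mem {k L : Type*} [Field k] [CommRing L] [Algebra k L]
    {B : Subalgebra k L} {a b : Fin 6} (hab : a ≠ b) {U V : L} {H : MvPolynomial (Fin 6) k}
    (hH : H.totalDegree ≤ 4)
    (h : MvPolynomial.aeval (pairValue a b U V) H ∈ coeffSubalgebra (Fin 6) B)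
    {s : Fin 6 →₀ ℕ} (ha : s a = 0) (hb : s b = 0) :
    ∑ i ∈ Finset.range 5, ∑ j ∈ Finset.range 5,
      algebraMap k L (H.coeff (s + Finsupp.single a i + Finsupp.single b j)) * U ^ i * V ^ j
        ∈ B := by
  classical
  have h1 := h s
  rw [MvPolynomial.as_sum H, map_sum, MvPolynomial.coeff_sum] at h1
  simp only [aeval_pairValue_monomial hab, MvPolynomial.coeff_monomial] at h1
  convert h1 using 1
  rw [← Finset.sum_product', ← Finset.sum_filter]
  symm
  -- An exponent that restricts to `s` away from `a`, `b` is determined by its two entries there.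
  -- Pairs with vanishing coefficient have no counterpart in the support, so only nonzero terms are
  -- matched.
  refine Finset.sum_bij_ne_zero (fun m _ _ => (m a, m b)) ?_ ?_ ?_ ?_
  · intro m hm _
    have hm1 : m ∈ H.support := (Finset.mem_filter.mp hm).1
    have hd := (MvPolynomial.le_totalDegree hm1).trans hH
    rw [Finsupp.sum_fintype _ _ (by simp)] at hd
    have h2 : ∀ i, m i ≤ ∑ i, m i := fun i =>
      Finset.single_le_sum (fun _ _ => Nat.zero_le _) (Finset.mem_univ i)
    have h3 := h2 a
    have h4 := h2 b
    simp only [Finset.mem_product, Finset.mem_range]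
    omega
  · intro m hm _ m' hm' _ he
    have e1 := (Finset.mem_filter.mp hm).2
    have e2 := (Finset.mem_filter.mp hm').2
    simp only [Prod.mk.injEq] at he
    ext i
    by_cases ha : i = a
    · rw [ha, he.1]
    by_cases hb : i = b
    · rw [hb, he.2]
    have := DFunLike.congr_fun (e1.trans e2.symm) i
    simpa [Finsupp.erase_ne, ha, hb] using this
  · rintro ⟨i, j⟩ _ hne
    have hs : ((s + Finsupp.single a i + Finsupp.single b j).erase a).erase b = s := by
      ext l
      by_cases hla : l = a
      · subst hla; simp [hab, ha]
      by_cases hlb : l = b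
      · subst hlb; simp [hb, Finsupp.erase_ne, hla]
      simp [Finsupp.erase_ne, hla, hlb]
    have hsa : (s + Finsupp.single a i + Finsupp.single b j) a = i := by
      simp [ha, hab]
    have hsb : (s + Finsupp.single a i + Finsupp.single b j) b = j := by
      simp [hb, hab]
    refine ⟨s + Finsupp.single a i + Finsupp.single b j, ?_, ?_, by rw [hsa, hsb]⟩
    · rw [Finset.mem_filter]
      refine ⟨?_, hs⟩
      rw [MvPolynomial.mem_support_iff]
      intro h0
      apply hne
      simp only [h0, map_zero, zero_mul]
    · rw [hsa, hsb]; exact hne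
  · intro m hm _
    have e1 := (Finset.mem_filter.mp hm).2
    have hs : s + Finsupp.single a (m a) + Finsupp.single b (m b) = m := by
      rw [← e1]
      ext l
      by_cases hla : l = a
      · subst hla; simp [hab]
      by_cases hlb : l = b
      · subst hlb; simp [hab]
      simp [Finsupp.erase_ne, hla, hlb]
    dsimp only
    rw [hs]

/-! ### Coefficient relations forced by vanishing polar parts -/

/-- Regularity of `∑ cᵢⱼ xⁱ yʲ` under `x = β/τ + γ/τ²`, `y = τ`. -/
theorem coeff_relations_of_double_pole {k : Type*} [Field k] [CharZero k] [Algebra (RatFunc ℂ) k]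
    {c : ℕ → ℕ → k} (hc : ∀ i j, 4 < i + j → c i j = 0) {β γ : k} (hγ : γ ≠ 0)
    (h : ∑ i ∈ Finset.range 5, ∑ j ∈ Finset.range 5, algebraMap k (RatF k) (c i j) *
      (algebraMap k (RatF k) β / tau k + algebraMap k (RatF k) γ / tau k ^ 2) ^ i * tau k ^ j
        ∈ regular k) :
    c 4 0 = 0 ∧ c 3 0 = 0 ∧ c 3 1 = 0 ∧ c 2 0 = 0 ∧ c 2 1 = 0 ∧ c 1 0 = -γ * c 2 2 ∧
      c 1 1 = -β * c 2 2 := by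
  have hτ := tau_ne_zero (R := k)
  -- The entries are the coefficients of τ^(-1), …, τ^(-8), once terms of degree above four are
  -- dropped.
  have key := eq_zero_of_sum_inv_mem (R := k) (e :=
    ![2 * β * γ * c 2 2 + β ^ 2 * c 2 1 + γ * c 1 1 + β * c 1 0,
      γ ^ 2 * c 2 2 + 2 * β * γ * c 2 1 + β ^ 2 * c 2 0 + β ^ 3 * c 3 1 + γ * c 1 0,
      γ ^ 2 * c 2 1 + 2 * β * γ * c 2 0 + 3 * β ^ 2 * γ * c 3 1 + β ^ 3 * c 3 0,
      γ ^ 2 * c 2 0 + 3 * β * γ ^ 2 * c 3 1 + 3 * β ^ 2 * γ * c 3 0 + β ^ 4 * c 4 0,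
      γ ^ 3 * c 3 1 + 3 * β * γ ^ 2 * c 3 0 + 4 * β ^ 3 * γ * c 4 0,
      γ ^ 3 * c 3 0 + 6 * β ^ 2 * γ ^ 2 * c 4 0,
      4 * β * γ ^ 3 * c 4 0,
      γ ^ 4 * c 4 0]) (by
    have hrest : algebraMap k (RatF k) (β ^ 2 * c 2 2 + c 1 2 * γ + β * c 1 1 + c 0 0)
        + algebraMap k (RatF k) (β * c 1 2 + γ * c 1 3 + c 0 1) * tau k
        + algebraMap k (RatF k) (β * c 1 3 + c 0 2) * tau k ^ 2
        + algebraMap k (RatF k) (c 0 3) * tau k ^ 3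
        + algebraMap k (RatF k) (c 0 4) * tau k ^ 4 ∈ regular k := by
      repeat' first
        | exact tau_mem
        | exact algebraMap_mem_regular _
        | refine pow_mem ?_ _
        | refine add_mem ?_ ?_
        | refine sub_mem ?_ ?_
        | refine mul_mem ?_ ?_
    convert sub_mem h hrest using 1
    simp only [Finset.sum_range_succ, Finset.sum_range_zero]
    rw [hc 1 4 (by norm_num), hc 2 3 (by norm_num), hc 2 4 (by norm_num), hc 3 2 (by norm_num),
      hc 3 3 (by norm_num), hc 3 4 (by norm_num), hc 4 1 (by norm_num), hc 4 2 (by norm_num),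
      hc 4 3 (by norm_num), hc 4 4 (by norm_num)]
    simp only [Fin.sum_univ_succ, Fin.sum_univ_zero, Matrix.cons_val_zero, Matrix.cons_val_succ,
      Fin.val_zero, Fin.val_succ, zero_add, Nat.reduceAdd, map_add, map_mul, map_pow, map_zero, map_ofNat]
    field_simp
    ring)
  have e0 := key 0
  have e1 := key 1
  have e2 := key 2
  have e3 := key 3
  have e4 := key 4
  have e5 := key 5
  have e7 := key 7
  simp only [Matrix.cons_val] at e0 e1 e2 e3 e4 e5 e7
  -- The system is triangular when solved from the highest pole downwards: orders 8, 6, 5, 4, 3, 2,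
  -- 1, dividing by powers of `γ` each time.
  have h40 : c 4 0 = 0 := by simpa [hγ] using e7
  have h30 : c 3 0 = 0 := by simpa [hγ, h40] using e5
  have h31 : c 3 1 = 0 := by simpa [hγ, h40, h30] using e4
  have h20 : c 2 0 = 0 := by simpa [hγ, h40, h30, h31] using e3
  have h21 : c 2 1 = 0 := by simpa [hγ, h40, h30, h31, h20] using e2
  have h10 : c 1 0 = -γ * c 2 2 := by
    rw [h21, h20, h31] at e1
    apply mul_left_cancel₀ hγ
    linear_combination e1
  refine ⟨h40, h30, h31, h20, h21, h10, ?_⟩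
  rw [h21, h10] at e0
  apply mul_left_cancel₀ hγ
  linear_combination e0

/-- Regularity of `∑ cᵢⱼ zⁱ wʲ` under `z = 1/τ`, `w = -(ωτ + a)τ` for all scalars `ω`. -/
theorem coeff_relations_of_simple_pole {k : Type*} [Field k] [CharZero k] [Algebra (RatFunc ℂ) k]
    {c : ℕ → ℕ → k} (hc : ∀ i j, 4 < i + j → c i j = 0) {a : k}
    (h : ∀ ω : k, ∑ i ∈ Finset.range 5, ∑ j ∈ Finset.range 5, algebraMap k (RatF k) (c i j) *
      (1 / tau k) ^ i * (-(algebraMap k (RatF k) ω * tau k + algebraMap k (RatF k) a) * tau k) ^ j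
        ∈ regular k) :
    c 4 0 = 0 ∧ c 3 0 = 0 ∧ c 3 1 = 0 ∧ c 2 0 = 0 ∧ c 1 0 = a * c 2 1 := by
  have hτ := tau_ne_zero (R := k)
  have key := fun ω : k => eq_zero_of_sum_inv_mem (R := k) (e :=
    ![c 1 0 - ω * c 3 1 - a * c 2 1, c 2 0 - a * c 3 1, c 3 0, c 4 0]) (by
    have hrest : algebraMap k (RatF k) (c 0 0) - algebraMap k (RatF k) (c 2 1 * ω)
        - algebraMap k (RatF k) (c 1 1) * (algebraMap k (RatF k) ω * tau k + algebraMap k (RatF k) a)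
        + (algebraMap k (RatF k) (c 2 2) + algebraMap k (RatF k) (c 1 2) * tau k
          + algebraMap k (RatF k) (c 0 2) * tau k ^ 2)
          * (algebraMap k (RatF k) ω * tau k + algebraMap k (RatF k) a) ^ 2
        + algebraMap k (RatF k) (c 0 1)
          * (-(algebraMap k (RatF k) ω * tau k + algebraMap k (RatF k) a) * tau k)
        + (algebraMap k (RatF k) (c 1 3) * tau k ^ 2 + algebraMap k (RatF k) (c 0 3) * tau k ^ 3)
          * (-(algebraMap k (RatF k) ω * tau k + algebraMap k (RatF k) a)) ^ 3
        + algebraMap k (RatF k) (c 0 4) * tau k ^ 4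
          * (algebraMap k (RatF k) ω * tau k + algebraMap k (RatF k) a) ^ 4 ∈ regular k := by
      repeat' first
        | exact tau_mem
        | exact algebraMap_mem_regular _
        | refine pow_mem ?_ _
        | refine add_mem ?_ ?_
        | refine sub_mem ?_ ?_
        | refine mul_mem ?_ ?_
        | refine neg_mem ?_
    convert sub_mem (h ω) hrest using 1
    simp only [Finset.sum_range_succ, Finset.sum_range_zero]
    rw [hc 1 4 (by norm_num), hc 2 3 (by norm_num), hc 2 4 (by norm_num), hc 3 2 (by norm_num),
      hc 3 3 (by norm_num), hc 3 4 (by norm_num), hc 4 1 (by norm_num), hc 4 2 (by norm_num),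
      hc 4 3 (by norm_num), hc 4 4 (by norm_num)]
    simp only [Fin.sum_univ_succ, Fin.sum_univ_zero, Matrix.cons_val_zero, Matrix.cons_val_succ,
      Fin.val_zero, Fin.val_succ, zero_add, Nat.reduceAdd, map_sub, map_mul, map_zero]
    field_simp
    ring)
  have e0 := key 0 0
  have e0' := key 1 0
  have e1 := key 0 1
  have e2 := key 0 2
  have e3 := key 0 3
  simp only [Matrix.cons_val] at e0 e0' e1 e2 e3
  -- The simple-pole coefficient is affine in ω with slope -c₃₁, so ω = 0 and ω = 1 separate its two
  -- parts.
  have h31 : c 3 1 = 0 := by linear_combination e0 - e0'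
  exact ⟨e3, e2, h31, by linear_combination e1 + a * h31, by linear_combination e0⟩

/-! ### The chart identities at points of arbitrary algebras -/

-- One constant `c` serves all algebras and points. The inverse of `y` is part of the data because
-- the identity is also needed in polynomial rings over R(τ), which are not fields.
open MvPolynomial in
theorem BecomesSystemOf.chart0_apply {α : Fin 5 → ℂ} {H K : PhasePoly}
    (h : BecomesSystemOf H (chart0 α) K) {a : RatFunc ℂ} (ha : a = algebraMap ℂ (RatFunc ℂ) (α 0)) :
    ∃ c : RatFunc ℂ, ∀ (S : Type) [CommRing S] [Nontrivial S] [Algebra (RatFunc ℂ) S]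
      (x y z w q p y' : S), y * y' = 1 →
      aeval ![x + 2 * algebraMap _ S a * y' + y' ^ 2, y, z, w, q, p] K
        = aeval ![x, y, z, w, q, p] H + algebraMap _ S c := by
  obtain ⟨c, hc⟩ := h.exists_chart0
  refine ⟨c, fun S _ _ _ x y z w q p y' hy => ?_⟩
  have hX := crd_ne_zero 1
  rw [aeval_eq_of_specialization (aeval ![x, y, z, w, q, p])
    ![X 0 * X 1 ^ 2 + (C a + C a) * X 1 + 1, X 1, X 2, X 3, X 4, X 5] ![X 1 ^ 2, 1, 1, 1, 1, 1]
    _ ?_ ?_ ?_ hc]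
  · simp
  · have hu : IsUnit y := IsUnit.of_mul_eq_one _ hy
    intro i
    fin_cases i <;> simp [hu]
  · intro i
    fin_cases i
    · have h1 : algebraMap PhasePoly PhaseField (X 0) = crd 0 := rfl
      have h2 : algebraMap PhasePoly PhaseField (X 1) = crd 1 := rfl
      have h3 : algebraMap PhasePoly PhaseField (C a) = cst (α 0) := by
        rw [cst_eq, ha, IsScalarTower.algebraMap_apply (RatFunc ℂ) PhasePoly PhaseField]; rfl
      simp [chart0, h1, h2, h3]
      field_simp
      ring
    all_goals simp [chart0, crd]
  · intro i
    fin_cases i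
    · simp
      linear_combination (2 * algebraMap _ S a * y + y * y' + 1) * hy
    all_goals simp

open MvPolynomial in
theorem BecomesSystemOf.chart1_apply {α : Fin 5 → ℂ} {H K : PhasePoly}
    (h : BecomesSystemOf H (chart1 α) K) {a : RatFunc ℂ} (ha : a = algebraMap ℂ (RatFunc ℂ) (α 1)) :
    ∃ c : RatFunc ℂ, ∀ (S : Type) [CommRing S] [Nontrivial S] [Algebra (RatFunc ℂ) S]
      (x y z w q p y' : S), y * y' = 1 →
      aeval ![-((x - z) * y - algebraMap _ S a) * y, y', z, w + y, q, p] K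
        = aeval ![x, y, z, w, q, p] H + algebraMap _ S c := by
  obtain ⟨c, hc⟩ := h.exists_chart1
  refine ⟨c, fun S _ _ _ x y z w q p y' hy => ?_⟩
  have hX := crd_ne_zero 1
  rw [aeval_eq_of_specialization (aeval ![x, y, z, w, q, p])
    ![-((X 0 - X 2) * X 1 - C a) * X 1, 1, X 2, X 3 + X 1, X 4, X 5] ![1, X 1, 1, 1, 1, 1]
    _ ?_ ?_ ?_ hc]
  · simp
  · have hu : IsUnit y := IsUnit.of_mul_eq_one _ hy
    intro i
    fin_cases i <;> simp [hu]
  · intro i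
    have h1 : ∀ i, algebraMap PhasePoly PhaseField (X i) = crd i := fun _ => rfl
    have h3 : algebraMap PhasePoly PhaseField (C a) = cst (α 1) := by
      rw [cst_eq, ha, IsScalarTower.algebraMap_apply (RatFunc ℂ) PhasePoly PhaseField]; rfl
    fin_cases i <;> simp [chart1, h1, h3, hX]
  · intro i
    have hy' : y' * y = 1 := by rw [mul_comm, hy]
    fin_cases i <;> simp [hy']

open MvPolynomial in
theorem BecomesSystemOf.chart2_apply {α : Fin 5 → ℂ} {H K : PhasePoly}
    (h : BecomesSystemOf H (chart2 α) K) {a : RatFunc ℂ} (ha : a = algebraMap ℂ (RatFunc ℂ) (α 2)) :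
    ∃ c : RatFunc ℂ, ∀ (S : Type) [CommRing S] [Nontrivial S] [Algebra (RatFunc ℂ) S]
      (x y z w q p z' : S), z * z' = 1 →
      aeval ![x, y, z', -(w * z + algebraMap _ S a) * z, q, p] K
        = aeval ![x, y, z, w, q, p] H + algebraMap _ S c := by
  obtain ⟨c, hc⟩ := h.exists_chart2
  refine ⟨c, fun S _ _ _ x y z w q p z' hz => ?_⟩
  have hX := crd_ne_zero 2
  rw [aeval_eq_of_specialization (aeval ![x, y, z, w, q, p])
    ![X 0, X 1, 1, -(X 3 * X 2 + C a) * X 2, X 4, X 5] ![1, 1, X 2, 1, 1, 1]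
    _ ?_ ?_ ?_ hc]
  · simp
  · have hu : IsUnit z := IsUnit.of_mul_eq_one _ hz
    intro i
    fin_cases i <;> simp [hu]
  · intro i
    have h1 : ∀ i, algebraMap PhasePoly PhaseField (X i) = crd i := fun _ => rfl
    have h3 : algebraMap PhasePoly PhaseField (C a) = cst (α 2) := by
      rw [cst_eq, ha, IsScalarTower.algebraMap_apply (RatFunc ℂ) PhasePoly PhaseField]; rfl
    fin_cases i <;> simp [chart2, h1, h3, hX]
  · intro i
    have hz' : z' * z = 1 := by rw [mul_comm, hz]
    fin_cases i <;> simp [hz']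

open MvPolynomial in
theorem BecomesSystemOf.chart3_apply {α : Fin 5 → ℂ} {H K : PhasePoly}
    (h : BecomesSystemOf H (chart3 α) K) {a : RatFunc ℂ} (ha : a = algebraMap ℂ (RatFunc ℂ) (α 3)) :
    ∃ c : RatFunc ℂ, ∀ (S : Type) [CommRing S] [Nontrivial S] [Algebra (RatFunc ℂ) S]
      (x y z w q p w' : S), w * w' = 1 →
      aeval ![x, y, -((z - q) * w - algebraMap _ S a) * w, w', q, p + w] K
        = aeval ![x, y, z, w, q, p] H + algebraMap _ S c := by
  obtain ⟨c, hc⟩ := h.exists_chart3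
  refine ⟨c, fun S _ _ _ x y z w q p w' hw => ?_⟩
  have hX := crd_ne_zero 3
  rw [aeval_eq_of_specialization (aeval ![x, y, z, w, q, p])
    ![X 0, X 1, -((X 2 - X 4) * X 3 - C a) * X 3, 1, X 4, X 5 + X 3] ![1, 1, 1, X 3, 1, 1]
    _ ?_ ?_ ?_ hc]
  · simp
  · have hu : IsUnit w := IsUnit.of_mul_eq_one _ hw
    intro i
    fin_cases i <;> simp [hu]
  · intro i
    have h1 : ∀ i, algebraMap PhasePoly PhaseField (X i) = crd i := fun _ => rfl
    have h3 : algebraMap PhasePoly PhaseField (C a) = cst (α 3) := by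
      rw [cst_eq, ha, IsScalarTower.algebraMap_apply (RatFunc ℂ) PhasePoly PhaseField]; rfl
    fin_cases i <;> simp [chart3, h1, h3, hX]
  · intro i
    have hw' : w' * w = 1 := by rw [mul_comm, hw]
    fin_cases i <;> simp [hw']

open MvPolynomial in
theorem BecomesSystemOf.chart4_apply {α : Fin 5 → ℂ} {H K : PhasePoly}
    (h : BecomesSystemOf H (chart4 α) K) {a : RatFunc ℂ} (ha : a = algebraMap ℂ (RatFunc ℂ) (α 4)) :
    ∃ c : RatFunc ℂ, ∀ (S : Type) [CommRing S] [Nontrivial S] [Algebra (RatFunc ℂ) S]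
      (x y z w q p p' : S), p * p' = 1 →
      aeval ![x, y, z, w, q + 2 * algebraMap _ S a * p' - algebraMap (RatFunc ℂ) S RatFunc.X * p' ^ 2, p] K
        = aeval ![x, y, z, w, q, p] H + p' + algebraMap _ S c := by
  obtain ⟨c, hc⟩ := h.exists_chart4
  refine ⟨c, fun S _ _ _ x y z w q p p' hp => ?_⟩
  have hX := crd_ne_zero 5
  -- The term 1/p is not polynomial, so the relation is multiplied by p, which the chart leaves
  -- unchanged, before specializing.
  have hc' : aeval (chart4 α) (K * X 5)
      = algebraMap PhasePoly PhaseField ((H + C c) * X 5 + 1) := by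
    have h5 : algebraMap PhasePoly PhaseField (X 5) = crd 5 := rfl
    have h6 : chart4 α 5 = crd 5 := rfl
    rw [map_mul, hc, aeval_X, h6, map_add _ (_ * _), map_mul, h5, map_one]
    field_simp
  have hu : IsUnit p := IsUnit.of_mul_eq_one (a := p) p' hp
  apply hu.mul_right_cancel
  have key := aeval_eq_of_specialization (aeval ![x, y, z, w, q, p])
    ![X 0, X 1, X 2, X 3, X 4 * X 5 ^ 2 + (C a + C a) * X 5 - C RatFunc.X, X 5]
    ![1, 1, 1, 1, X 5 ^ 2, 1]
    ![x, y, z, w, q + 2 * algebraMap _ S a * p' - algebraMap (RatFunc ℂ) S RatFunc.X * p' ^ 2, p]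
    ?_ ?_ ?_ hc'
  · simp at key
    rw [key]
    linear_combination -hp
  · intro i
    fin_cases i <;> simp [hu]
  · intro i
    have h1 : ∀ i, algebraMap PhasePoly PhaseField (X i) = crd i := fun _ => rfl
    have h3 : algebraMap PhasePoly PhaseField (C a) = cst (α 4) := by
      rw [cst_eq, ha, IsScalarTower.algebraMap_apply (RatFunc ℂ) PhasePoly PhaseField]; rfl
    have h4 : algebraMap PhasePoly PhaseField (C RatFunc.X) = timeF := by
      rw [timeF, IsScalarTower.algebraMap_apply (RatFunc ℂ) PhasePoly PhaseField]; rfl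
    fin_cases i <;> simp [chart4, h1, h3, h4]
    field_simp
    ring
  · intro i
    fin_cases i <;> simp
    linear_combination (2 * algebraMap _ S a * p - algebraMap (RatFunc ℂ) S RatFunc.X * (p * p' + 1)) * hp

/-! ### The monomials allowed by r₀, r₂ and r₄ -/

/-- The exponent of the monomial `xⁱ yʲ zᵏ wˡ qᵐ pⁿ`. -/
def expo (i j k l m n : ℕ) : Fin 6 →₀ ℕ := Finsupp.equivFunOnFinite.symm ![i, j, k, l, m, n]

theorem expo_apply (i j k l m n : ℕ) (r : Fin 6) : expo i j k l m n r = ![i, j, k, l, m, n] r := rfl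

theorem eq_expo (s : Fin 6 →₀ ℕ) : s = expo (s 0) (s 1) (s 2) (s 3) (s 4) (s 5) := by
  ext r
  fin_cases r <;> rfl

theorem expo_inj {i j k l m n i' j' k' l' m' n' : ℕ} :
    expo i j k l m n = expo i' j' k' l' m' n' ↔
      i = i' ∧ j = j' ∧ k = k' ∧ l = l' ∧ m = m' ∧ n = n' := by
  simp [expo]

theorem sum_expo (i j k l m n : ℕ) :
    ((expo i j k l m n).sum fun _ e => e) = i + j + k + l + m + n := by
  rw [Finsupp.sum_fintype _ _ (by simp), Fin.sum_univ_six]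
  rfl

theorem monomial_expo {R : Type*} [CommSemiring R] (i j k l m n : ℕ) (c : R) :
    MvPolynomial.monomial (expo i j k l m n) c
      = MvPolynomial.C c * (MvPolynomial.X 0 ^ i * MvPolynomial.X 1 ^ j * MvPolynomial.X 2 ^ k
        * MvPolynomial.X 3 ^ l * MvPolynomial.X 4 ^ m * MvPolynomial.X 5 ^ n) := by
  rw [MvPolynomial.monomial_eq, Finsupp.prod_fintype _ _ (by simp), Fin.prod_univ_six]
  rfl

theorem coeff_expo_eq_zero {R : Type*} [CommSemiring R] {H : MvPolynomial (Fin 6) R}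
    (hH : H.totalDegree ≤ 4) {i j k l m n : ℕ} (h : 4 < i + j + k + l + m + n) :
    H.coeff (expo i j k l m n) = 0 := by
  by_contra h0
  have := MvPolynomial.le_totalDegree (MvPolynomial.mem_support_iff.mpr h0)
  rw [sum_expo] at this
  omega

theorem C_tau_mul_C_inv :
    (MvPolynomial.C (tau (RatFunc ℂ)) : MvPolynomial (Fin 6) (RatF (RatFunc ℂ)))
      * MvPolynomial.C (tau (RatFunc ℂ))⁻¹ = 1 := by
  rw [← map_mul, ← map_one MvPolynomial.C]
  congr 1
  exact mul_inv_cancel₀ (G₀ := RatF (RatFunc ℂ)) tau_ne_zero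

theorem expo_eq_add_single₀₁ (i j k l m n : ℕ) :
    expo i j k l m n = expo 0 0 k l m n + Finsupp.single 0 i + Finsupp.single 1 j := by
  ext r
  fin_cases r <;> simp [expo_apply]

theorem expo_eq_add_single₂₃ (i j k l m n : ℕ) :
    expo i j k l m n = expo i j 0 0 m n + Finsupp.single 2 k + Finsupp.single 3 l := by
  ext r
  fin_cases r <;> simp [expo_apply]

theorem expo_eq_add_single₄₅ (i j k l m n : ℕ) :
    expo i j k l m n = expo i j k l 0 0 + Finsupp.single 4 m + Finsupp.single 5 n := by
  ext r
  fin_cases r <;> simp [expo_apply]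

/-- Taking new coordinates x₀ = 0, y₀ = τ gives x = -2a/τ - 1/τ², y = τ. This is the double-pole
substitution with β = -2a and γ = -1. -/
theorem coeff_chart0 {α : Fin 5 → ℂ} {H K : PhasePoly} (hH : H.totalDegree ≤ 4)
    (h : BecomesSystemOf H (chart0 α) K) {a : RatFunc ℂ} (ha : a = algebraMap ℂ (RatFunc ℂ) (α 0))
    (k l m n : ℕ) :
    H.coeff (expo 4 0 k l m n) = 0 ∧ H.coeff (expo 3 0 k l m n) = 0 ∧
    H.coeff (expo 3 1 k l m n) = 0 ∧ H.coeff (expo 2 0 k l m n) = 0 ∧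
    H.coeff (expo 2 1 k l m n) = 0 ∧
    H.coeff (expo 1 0 k l m n) = H.coeff (expo 2 2 k l m n) ∧
    H.coeff (expo 1 1 k l m n) = 2 * a * H.coeff (expo 2 2 k l m n) := by
  obtain ⟨c, hc⟩ := h.chart0_apply ha
  have hτ := tau_ne_zero (R := RatFunc ℂ)
  have hreg : MvPolynomial.aeval (pairValue 0 1
      (algebraMap (RatFunc ℂ) (RatF (RatFunc ℂ)) (-2 * a) / tau _
        + algebraMap (RatFunc ℂ) (RatF (RatFunc ℂ)) (-1) / tau _ ^ 2) (tau (RatFunc ℂ))) H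
        ∈ coeffSubalgebra (Fin 6) (regular (RatFunc ℂ)) := by
    have h1 := hc (MvPolynomial (Fin 6) (RatF (RatFunc ℂ)))
      (MvPolynomial.C (algebraMap (RatFunc ℂ) (RatF (RatFunc ℂ)) (-2 * a) / tau _
        + algebraMap (RatFunc ℂ) (RatF (RatFunc ℂ)) (-1) / tau _ ^ 2))
      (MvPolynomial.C (tau _)) (MvPolynomial.X 2) (MvPolynomial.X 3) (MvPolynomial.X 4)
      (MvPolynomial.X 5) (MvPolynomial.C (tau _)⁻¹)
      C_tau_mul_C_inv
    have h2 : pairValue (0 : Fin 6) 1 (algebraMap (RatFunc ℂ) (RatF (RatFunc ℂ)) (-2 * a) / tau _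
        + algebraMap (RatFunc ℂ) (RatF (RatFunc ℂ)) (-1) / tau _ ^ 2) (tau (RatFunc ℂ))
        = ![MvPolynomial.C (algebraMap (RatFunc ℂ) (RatF (RatFunc ℂ)) (-2 * a) / tau _
        + algebraMap (RatFunc ℂ) (RatF (RatFunc ℂ)) (-1) / tau _ ^ 2),
          MvPolynomial.C (tau _), MvPolynomial.X 2, MvPolynomial.X 3, MvPolynomial.X 4,
          MvPolynomial.X 5] := by
      ext1 r
      fin_cases r <;> rfl
    rw [h2, ← sub_eq_iff_eq_add.mpr h1]
    refine sub_mem (aeval_mem_subalgebra (fun r => ?_) K) (Subalgebra.algebraMap_mem _ _)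
    have h3 : ∀ r : Fin 6, ![(0 : MvPolynomial (Fin 6) (RatF (RatFunc ℂ))), MvPolynomial.C (tau _),
        MvPolynomial.X 2, MvPolynomial.X 3, MvPolynomial.X 4, MvPolynomial.X 5] r
        ∈ coeffSubalgebra (Fin 6) (regular (RatFunc ℂ)) := by
      intro r
      fin_cases r
      · exact zero_mem _
      · exact C_mem_coeffSubalgebra tau_mem
      all_goals exact X_mem_coeffSubalgebra _
    convert h3 r using 3
    rw [IsScalarTower.algebraMap_apply (RatFunc ℂ) (RatF (RatFunc ℂ))
      (MvPolynomial (Fin 6) (RatF (RatFunc ℂ))), MvPolynomial.algebraMap_eq,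
      ← map_ofNat MvPolynomial.C 2, ← map_mul, ← map_mul, ← map_pow, ← map_add, ← map_add,
      ← map_zero MvPolynomial.C]
    congr 1
    simp only [map_mul, map_neg, map_ofNat, map_one]
    field_simp
    ring
  have key := coeff_relations_of_double_pole (k := RatFunc ℂ)
    (c := fun i j => H.coeff (expo i j k l m n)) (β := -2 * a) (γ := -1)
    (fun i j hij => coeff_expo_eq_zero hH (by omega)) (by simp) (by
      convert sum_coeff_mem_of_aeval_pairValue_mem (s := expo 0 0 k l m n) (by decide) hH hreg
        rfl rfl using 8 with i _ j _
      exact expo_eq_add_single₀₁ i j k l m n)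
  obtain ⟨h40, h30, h31, h20, h21, h10, h11⟩ := key
  exact ⟨h40, h30, h31, h20, h21, by linear_combination h10, by linear_combination h11⟩

/-- The test points have new coordinates z₂ = τ and w₂ = ω, with ω ranging over ℂ(t). -/
theorem coeff_chart2 {α : Fin 5 → ℂ} {H K : PhasePoly} (hH : H.totalDegree ≤ 4)
    (h : BecomesSystemOf H (chart2 α) K) {a : RatFunc ℂ} (ha : a = algebraMap ℂ (RatFunc ℂ) (α 2))
    (i j m n : ℕ) :
    H.coeff (expo i j 4 0 m n) = 0 ∧ H.coeff (expo i j 3 0 m n) = 0 ∧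
    H.coeff (expo i j 3 1 m n) = 0 ∧ H.coeff (expo i j 2 0 m n) = 0 ∧
    H.coeff (expo i j 1 0 m n) = a * H.coeff (expo i j 2 1 m n) := by
  obtain ⟨c, hc⟩ := h.chart2_apply ha
  have hτ := tau_ne_zero (R := RatFunc ℂ)
  have hreg : ∀ ω : RatFunc ℂ, MvPolynomial.aeval (pairValue 2 3 (1 / tau (RatFunc ℂ))
      (-(algebraMap (RatFunc ℂ) (RatF (RatFunc ℂ)) ω * tau _
        + algebraMap (RatFunc ℂ) (RatF (RatFunc ℂ)) a) * tau _)) H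
        ∈ coeffSubalgebra (Fin 6) (regular (RatFunc ℂ)) := by
    intro ω
    have h1 := hc (MvPolynomial (Fin 6) (RatF (RatFunc ℂ)))
      (MvPolynomial.X 0) (MvPolynomial.X 1) (MvPolynomial.C (1 / tau (RatFunc ℂ)))
      (MvPolynomial.C (-(algebraMap (RatFunc ℂ) (RatF (RatFunc ℂ)) ω * tau _
        + algebraMap (RatFunc ℂ) (RatF (RatFunc ℂ)) a) * tau _)) (MvPolynomial.X 4)
      (MvPolynomial.X 5) (MvPolynomial.C (tau _))
      (by
        rw [mul_comm]
        convert C_tau_mul_C_inv using 3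
        exact one_div (G := RatF (RatFunc ℂ)) _)
    have h2 : pairValue (2 : Fin 6) 3 (1 / tau (RatFunc ℂ))
      (-(algebraMap (RatFunc ℂ) (RatF (RatFunc ℂ)) ω * tau _
        + algebraMap (RatFunc ℂ) (RatF (RatFunc ℂ)) a) * tau _)
        = ![MvPolynomial.X 0, MvPolynomial.X 1, MvPolynomial.C (1 / tau (RatFunc ℂ)),
      MvPolynomial.C (-(algebraMap (RatFunc ℂ) (RatF (RatFunc ℂ)) ω * tau _
        + algebraMap (RatFunc ℂ) (RatF (RatFunc ℂ)) a) * tau _), MvPolynomial.X 4,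
          MvPolynomial.X 5] := by
      ext1 r
      fin_cases r <;> rfl
    rw [h2, ← sub_eq_iff_eq_add.mpr h1]
    refine sub_mem (aeval_mem_subalgebra (fun r => ?_) K) (Subalgebra.algebraMap_mem _ _)
    have h3 : ∀ r : Fin 6, ![MvPolynomial.X 0, MvPolynomial.X 1, MvPolynomial.C (tau (RatFunc ℂ)),
        MvPolynomial.C (algebraMap (RatFunc ℂ) (RatF (RatFunc ℂ)) ω), MvPolynomial.X 4,
        MvPolynomial.X 5] r
        ∈ coeffSubalgebra (Fin 6) (regular (RatFunc ℂ)) := by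
      intro r
      fin_cases r
      · exact X_mem_coeffSubalgebra _
      · exact X_mem_coeffSubalgebra _
      · exact C_mem_coeffSubalgebra tau_mem
      · exact C_mem_coeffSubalgebra (algebraMap_mem_regular _)
      all_goals exact X_mem_coeffSubalgebra _
    convert h3 r using 6
    rw [IsScalarTower.algebraMap_apply (RatFunc ℂ) (RatF (RatFunc ℂ))
      (MvPolynomial (Fin 6) (RatF (RatFunc ℂ))), MvPolynomial.algebraMap_eq,
      ← map_mul, ← map_add, ← map_neg, ← map_mul]
    congr 1
    field_simp
    ring
  have key := coeff_relations_of_simple_pole (k := RatFunc ℂ)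
    (c := fun k l => H.coeff (expo i j k l m n)) (a := a)
    (fun i j hij => coeff_expo_eq_zero hH (by omega)) (fun ω => by
      convert sum_coeff_mem_of_aeval_pairValue_mem (s := expo i j 0 0 m n) (by decide) hH (hreg ω)
        rfl rfl using 8 with k _ l _
      exact expo_eq_add_single₂₃ i j k l m n)
  exact key

/-- The test point is q₄ = 0, p₄ = τ, so β = -2a and γ = t. The correction 1/p changes only the
coefficient of the pure monomial qp, which explains the case distinction. -/
theorem coeff_chart4 {α : Fin 5 → ℂ} {H K : PhasePoly} (hH : H.totalDegree ≤ 4)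
    (h : BecomesSystemOf H (chart4 α) K) {a : RatFunc ℂ} (ha : a = algebraMap ℂ (RatFunc ℂ) (α 4))
    (i j k l : ℕ) :
    H.coeff (expo i j k l 4 0) = 0 ∧ H.coeff (expo i j k l 3 0) = 0 ∧
    H.coeff (expo i j k l 3 1) = 0 ∧ H.coeff (expo i j k l 2 0) = 0 ∧
    H.coeff (expo i j k l 2 1) = 0 ∧
    H.coeff (expo i j k l 1 0) = -RatFunc.X * H.coeff (expo i j k l 2 2) ∧
    H.coeff (expo i j k l 1 1) = 2 * a * H.coeff (expo i j k l 2 2)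
      - if expo i j k l 0 0 = 0 then 1 / RatFunc.X else 0 := by
  obtain ⟨c, hc⟩ := h.chart4_apply ha
  have hτ := tau_ne_zero (R := RatFunc ℂ)
  have ht : (RatFunc.X : RatFunc ℂ) ≠ 0 := RatFunc.X_ne_zero
  have ht' : algebraMap (RatFunc ℂ) (RatF (RatFunc ℂ)) RatFunc.X ≠ 0 := by
    simpa using ht
  -- At the test point qp/t equals 1/τ - 2a/t. Adding it to `H` therefore absorbs 1/p up to an
  -- element of ℂ(t), and `G` is regular.
  set G : PhasePoly := H + MvPolynomial.monomial (expo 0 0 0 0 1 1) (1 / RatFunc.X) with hG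
  have hGd : G.totalDegree ≤ 4 := by
    refine (MvPolynomial.totalDegree_add _ _).trans (max_le hH ?_)
    refine (MvPolynomial.totalDegree_monomial_le _ _).trans ?_
    change ((expo 0 0 0 0 1 1).sum fun _ e => e) ≤ 4
    rw [sum_expo]
    norm_num
  have hreg : MvPolynomial.aeval (pairValue 4 5
      (algebraMap (RatFunc ℂ) (RatF (RatFunc ℂ)) (-2 * a) / tau _
        + algebraMap (RatFunc ℂ) (RatF (RatFunc ℂ)) RatFunc.X / tau _ ^ 2) (tau (RatFunc ℂ))) G
        ∈ coeffSubalgebra (Fin 6) (regular (RatFunc ℂ)) := by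
    have h1 := hc (MvPolynomial (Fin 6) (RatF (RatFunc ℂ)))
      (MvPolynomial.X 0) (MvPolynomial.X 1) (MvPolynomial.X 2) (MvPolynomial.X 3)
      (MvPolynomial.C (algebraMap (RatFunc ℂ) (RatF (RatFunc ℂ)) (-2 * a) / tau _
        + algebraMap (RatFunc ℂ) (RatF (RatFunc ℂ)) RatFunc.X / tau _ ^ 2))
      (MvPolynomial.C (tau _)) (MvPolynomial.C (tau _)⁻¹)
      C_tau_mul_C_inv
    have h2 : pairValue (4 : Fin 6) 5 (algebraMap (RatFunc ℂ) (RatF (RatFunc ℂ)) (-2 * a) / tau _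
        + algebraMap (RatFunc ℂ) (RatF (RatFunc ℂ)) RatFunc.X / tau _ ^ 2) (tau (RatFunc ℂ))
        = ![MvPolynomial.X 0, MvPolynomial.X 1, MvPolynomial.X 2, MvPolynomial.X 3,
          MvPolynomial.C (algebraMap (RatFunc ℂ) (RatF (RatFunc ℂ)) (-2 * a) / tau _
            + algebraMap (RatFunc ℂ) (RatF (RatFunc ℂ)) RatFunc.X / tau _ ^ 2),
          MvPolynomial.C (tau _)] := by
      ext1 r
      fin_cases r <;> rfl
    have h4 : ∀ r : RatFunc ℂ, algebraMap (RatFunc ℂ) (MvPolynomial (Fin 6) (RatF (RatFunc ℂ))) r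
        = MvPolynomial.C (algebraMap (RatFunc ℂ) (RatF (RatFunc ℂ)) r) := fun r => rfl
    have h5 : MvPolynomial.aeval (pairValue (4 : Fin 6) 5
        (algebraMap (RatFunc ℂ) (RatF (RatFunc ℂ)) (-2 * a) / tau _
        + algebraMap (RatFunc ℂ) (RatF (RatFunc ℂ)) RatFunc.X / tau _ ^ 2) (tau (RatFunc ℂ)))
        (MvPolynomial.monomial (expo 0 0 0 0 1 1) (1 / RatFunc.X : RatFunc ℂ))
        = MvPolynomial.C (tau (RatFunc ℂ))⁻¹ + algebraMap (RatFunc ℂ) _ (-2 * a / RatFunc.X) := by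
      rw [monomial_expo, h2]
      simp only [map_mul, MvPolynomial.aeval_C, MvPolynomial.aeval_X, Matrix.cons_val,
        pow_zero, pow_one, one_mul, h4]
      rw [← map_mul, ← map_mul, ← map_add]
      congr 1
      simp only [map_mul, map_div₀, map_neg, map_ofNat, map_one]
      field_simp
      ring
    rw [hG, map_add, h5, h2, ← add_assoc]
    refine add_mem ?_ (Subalgebra.algebraMap_mem _ _)
    rw [← sub_eq_iff_eq_add.mpr h1]
    refine sub_mem (aeval_mem_subalgebra (fun r => ?_) K) (Subalgebra.algebraMap_mem _ _)
    have h3 : ∀ r : Fin 6, ![MvPolynomial.X 0, MvPolynomial.X 1, MvPolynomial.X 2, MvPolynomial.X 3,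
        (0 : MvPolynomial (Fin 6) (RatF (RatFunc ℂ))), MvPolynomial.C (tau _)] r
        ∈ coeffSubalgebra (Fin 6) (regular (RatFunc ℂ)) := by
      intro r
      fin_cases r
      on_goal 5 => exact zero_mem _
      on_goal 5 => exact C_mem_coeffSubalgebra tau_mem
      all_goals exact X_mem_coeffSubalgebra _
    convert h3 r using 7
    rw [h4, h4, ← map_ofNat MvPolynomial.C 2, ← map_mul, ← map_mul, ← map_pow, ← map_mul,
      ← map_add, ← map_sub, ← map_zero MvPolynomial.C]
    congr 1
    simp only [map_mul, map_neg, map_ofNat]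
    field_simp
    ring
  have hcoeff : ∀ m n, G.coeff (expo i j k l m n) = H.coeff (expo i j k l m n)
      + if expo i j k l m n = expo 0 0 0 0 1 1 then 1 / RatFunc.X else 0 := by
    classical
    intro m n
    rw [hG, MvPolynomial.coeff_add, MvPolynomial.coeff_monomial]
    simp only [eq_comm]
  have key := coeff_relations_of_double_pole (k := RatFunc ℂ)
    (c := fun m n => G.coeff (expo i j k l m n)) (β := -2 * a) (γ := RatFunc.X)
    (fun i j hij => coeff_expo_eq_zero hGd (by omega)) ht (by
      convert sum_coeff_mem_of_aeval_pairValue_mem (s := expo i j k l 0 0) (by decide) hGd hreg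
        rfl rfl using 8 with m _ n _
      exact expo_eq_add_single₄₅ i j k l m n)
  simp only [hcoeff, expo_inj] at key
  obtain ⟨h40, h30, h31, h20, h21, h10, h11⟩ := key
  have h0 : expo i j k l 0 0 = 0 ↔ i = 0 ∧ j = 0 ∧ k = 0 ∧ l = 0 := by
    have : (0 : Fin 6 →₀ ℕ) = expo 0 0 0 0 0 0 := by
      ext r
      fin_cases r <;> rfl
    rw [this, expo_inj]
    simp
  simp at h40 h30 h31 h20 h21 h10 h11
  refine ⟨h40, h30, h31, h20, h21, by linear_combination h10, ?_⟩
  rw [if_congr h0 rfl rfl, one_div]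
  linear_combination h11

/-- The exponents, besides those of `ℂ(t)[y, w, p]` and `zw ℂ(t)[y, w, p]`, that charts
`r₀`, `r₂`, `r₄` allow in degree at most four. -/
def specialExponents : List (Fin 6 →₀ ℕ) :=
  [expo 2 2 0 0 0 0, expo 1 0 0 0 0 0, expo 1 1 0 0 0 0,
    expo 1 2 0 0 0 0, expo 1 3 0 0 0 0, expo 1 2 0 1 0 0, expo 1 2 0 0 0 1,
    expo 0 0 2 2 0 0, expo 0 0 2 1 0 0, expo 0 1 2 1 0 0, expo 0 0 2 1 0 1,
    expo 0 0 1 0 0 0, expo 0 1 1 0 0 0, expo 0 0 1 0 0 1,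
    expo 0 0 0 0 2 2, expo 0 0 0 0 1 0, expo 0 0 0 0 1 1,
    expo 0 0 0 0 1 2, expo 0 0 0 0 1 3, expo 0 1 0 0 1 2, expo 0 0 0 1 1 2]

theorem specialExponents_nodup : specialExponents.Nodup := by
  simp [specialExponents, expo_inj]

open MvPolynomial in
/-- Splitting of a polynomial according to a condition on its support. -/
theorem eq_sum_of_support {k : Type*} [Field k] {H : MvPolynomial (Fin 6) k}
    (h : ∀ s ∈ H.support, (s 0 = 0 ∧ s 2 = 0 ∧ s 4 = 0) ∨
      (s 0 = 0 ∧ s 2 = 1 ∧ s 4 = 0 ∧ 1 ≤ s 3) ∨ s ∈ specialExponents) :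
    ∃ P N : MvPolynomial (Fin 3) k,
      H = aeval ![X 1, X 3, X 5] P + X 2 * X 3 * aeval ![X 1, X 3, X 5] N
        + (specialExponents.map fun s => monomial s (H.coeff s)).sum := by
  classical
  let e : ℕ → ℕ → ℕ → (Fin 3 →₀ ℕ) := fun a b c => Finsupp.equivFunOnFinite.symm ![a, b, c]
  have he : ∀ a b c (r : k), aeval (![X 1, X 3, X 5] : Fin 3 → MvPolynomial (Fin 6) k)
      (monomial (e a b c) r) = C r * (X 1 ^ a * X 3 ^ b * X 5 ^ c) := by
    intro a b c r
    rw [aeval_monomial, Finsupp.prod_fintype _ _ (by simp), Fin.prod_univ_three]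
    rfl
  let A := H.support.filter fun s => s 0 = 0 ∧ s 2 = 0 ∧ s 4 = 0
  let B := H.support.filter fun s => s 0 = 0 ∧ s 2 = 1 ∧ s 4 = 0 ∧ 1 ≤ s 3
  let D := specialExponents.toFinset
  refine ⟨∑ s ∈ A, monomial (e (s 1) (s 3) (s 5)) (H.coeff s),
    -- One factor w is taken out in front of N; 1 ≤ s 3 on `B` makes the truncated subtraction
    -- exact.
    ∑ s ∈ B, monomial (e (s 1) (s 3 - 1) (s 5)) (H.coeff s), ?_⟩
  have hA : aeval ![X 1, X 3, X 5] (∑ s ∈ A, monomial (e (s 1) (s 3) (s 5)) (H.coeff s))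
      = ∑ s ∈ A, monomial s (H.coeff s) := by
    rw [map_sum]
    refine Finset.sum_congr rfl fun s hs => ?_
    obtain ⟨h0, h2, h4⟩ := (Finset.mem_filter.mp hs).2
    rw [he]
    nth_rw 5 [eq_expo s]
    rw [monomial_expo, h0, h2, h4]
    ring
  have hB : X 2 * X 3 * aeval ![X 1, X 3, X 5]
        (∑ s ∈ B, monomial (e (s 1) (s 3 - 1) (s 5)) (H.coeff s))
      = ∑ s ∈ B, monomial s (H.coeff s) := by
    rw [map_sum, Finset.mul_sum]
    refine Finset.sum_congr rfl fun s hs => ?_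
    obtain ⟨h0, h2, h4, h3⟩ := (Finset.mem_filter.mp hs).2
    rw [he]
    nth_rw 5 [eq_expo s]
    rw [monomial_expo, h0, h2, h4]
    obtain ⟨l, hl⟩ := Nat.exists_eq_add_of_le h3
    rw [hl, Nat.add_sub_cancel_left]
    ring
  have hD : (specialExponents.map fun s => monomial s (H.coeff s)).sum
      = ∑ s ∈ D, monomial s (H.coeff s) := (List.sum_toFinset _ specialExponents_nodup).symm
  rw [hA, hB, hD]
  have hspecial : ∀ s ∈ specialExponents, ¬ (s 0 = 0 ∧ s 2 = 0 ∧ s 4 = 0) ∧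
      ¬ (s 0 = 0 ∧ s 2 = 1 ∧ s 4 = 0 ∧ 1 ≤ s 3) := by
    simp [specialExponents, expo_apply]
  have hAB : Disjoint A B := by
    rw [Finset.disjoint_filter]
    rintro s _ ⟨_, h2, _⟩ ⟨_, h2', _⟩
    omega
  have hABD : Disjoint (A ∪ B) D := by
    rw [Finset.disjoint_left]
    intro s hs hsD
    have := hspecial s (List.mem_toFinset.mp hsD)
    rcases Finset.mem_union.mp hs with hs | hs
    · exact this.1 (Finset.mem_filter.mp hs).2
    · exact this.2 (Finset.mem_filter.mp hs).2
  rw [← Finset.sum_union hAB, ← Finset.sum_union hABD]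
  conv_lhs => rw [as_sum H]
  refine Finset.sum_subset (fun s hs => ?_) (fun s _ hs => ?_)
  · rcases h s hs with h1 | h1 | h1
    · exact Finset.mem_union_left _ (Finset.mem_union_left _ (Finset.mem_filter.mpr ⟨hs, h1⟩))
    · exact Finset.mem_union_left _ (Finset.mem_union_right _ (Finset.mem_filter.mpr ⟨hs, h1⟩))
    · exact Finset.mem_union_right _ (List.mem_toFinset.mpr h1)
  · rw [notMem_support_iff.mp hs, monomial_zero]

/-- The hypotheses encode the coefficient relations. For instance, the coefficients of x·m and xy·m
are multiples of that of x²y²·m, which has degree above four unless m = 1; likewise z·m is tied to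
z²w·m, so m has degree at most one. What remains is a finite check. -/
theorem exponent_cases {i j k l m n : ℕ} (hd : i + j + k + l + m + n ≤ 4)
    (hx : i ≤ 2) (hx₂ : i = 2 → 2 ≤ j) (hx₁ : i = 1 → j ≤ 1 → k + l + m + n = 0)
    (hz : k ≤ 2) (hz₂ : k = 2 → 1 ≤ l) (hz₁ : k = 1 → l = 0 → i + j + m + n ≤ 1)
    (hq : m ≤ 2) (hq₂ : m = 2 → 2 ≤ n) (hq₁ : m = 1 → n ≤ 1 → i + j + k + l = 0) :
    (i = 0 ∧ k = 0 ∧ m = 0) ∨ (i = 0 ∧ k = 1 ∧ m = 0 ∧ 1 ≤ l) ∨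
      expo i j k l m n ∈ specialExponents := by
  simp only [specialExponents, List.mem_cons, List.not_mem_nil, expo_inj, or_false]
  have hj : j ≤ 4 := by omega
  have hl : l ≤ 4 := by omega
  have hn : n ≤ 4 := by omega
  interval_cases i <;> interval_cases k <;> interval_cases m <;> try (exfalso; omega)
  all_goals interval_cases j <;> try (exfalso; omega)
  all_goals interval_cases l <;> try (exfalso; omega)
  all_goals interval_cases n <;> first | (exfalso; omega) | simp

open MvPolynomial in
/-- The shape that the charts `r₀`, `r₂`, `r₄` impose on a Hamiltonian of degree at most four. -/
theorem exists_shape_of_charts₀₂₄ {α : Fin 5 → ℂ} {H K₀ K₂ K₄ : PhasePoly} (hH : H.totalDegree ≤ 4)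
    (h0 : BecomesSystemOf H (chart0 α) K₀) (h2 : BecomesSystemOf H (chart2 α) K₂)
    (h4 : BecomesSystemOf H (chart4 α) K₄) {a₀ a₂ a₄ : RatFunc ℂ}
    (ha₀ : a₀ = algebraMap ℂ (RatFunc ℂ) (α 0)) (ha₂ : a₂ = algebraMap ℂ (RatFunc ℂ) (α 2))
    (ha₄ : a₄ = algebraMap ℂ (RatFunc ℂ) (α 4)) :
    ∃ (A B A' g₀ g₁ g₂ c₀ c₁ c₂ c₃ d₀ d₁ d₂ d₃ : RatFunc ℂ) (P N : MvPolynomial (Fin 3) (RatFunc ℂ)),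
      H = C A * (X 0 ^ 2 * X 1 ^ 2 + 2 * C a₀ * X 0 * X 1 + X 0)
        + C B * X 2 ^ 2 * X 3 ^ 2 + (X 2 ^ 2 * X 3 + C a₂ * X 2) * (C g₀ + C g₁ * X 1 + C g₂ * X 5)
        + X 0 * X 1 ^ 2 * (C c₀ + C c₁ * X 1 + C c₂ * X 3 + C c₃ * X 5)
        + C A' * (X 4 ^ 2 * X 5 ^ 2 + 2 * C a₄ * X 4 * X 5 - C RatFunc.X * X 4)
        - C (1 / RatFunc.X) * X 4 * X 5
        + X 4 * X 5 ^ 2 * (C d₀ + C d₁ * X 5 + C d₂ * X 1 + C d₃ * X 3)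
        + X 2 * X 3 * aeval ![X 1, X 3, X 5] N + aeval ![X 1, X 3, X 5] P := by
  have r0 := coeff_chart0 hH h0 ha₀
  have r2 := coeff_chart2 hH h2 ha₂
  have r4 := coeff_chart4 hH h4 ha₄
  have hd := fun i j k l m n => coeff_expo_eq_zero hH (i := i) (j := j) (k := k) (l := l)
    (m := m) (n := n)
  obtain ⟨P, N, hPN⟩ := eq_sum_of_support (H := H) (by
    intro s hs
    have hne := mem_support_iff.mp hs
    have hle := (le_totalDegree hs).trans hH
    rw [eq_expo s] at hne hle
    rw [sum_expo] at hle
    suffices hs' : ∀ i j k l m n : ℕ, H.coeff (expo i j k l m n) ≠ 0 →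
        i + j + k + l + m + n ≤ 4 → (i = 0 ∧ k = 0 ∧ m = 0) ∨ (i = 0 ∧ k = 1 ∧ m = 0 ∧ 1 ≤ l) ∨
          expo i j k l m n ∈ specialExponents by
      have := hs' _ _ _ _ _ _ hne hle
      rwa [← eq_expo s] at this
    clear hne hle
    intro i j k l m n hne hle
    obtain ⟨x40, x30, x31, x20, x21, x10, x11⟩ := r0 k l m n
    obtain ⟨z40, z30, z31, z20, z10⟩ := r2 i j m n
    obtain ⟨q40, q30, q31, q20, q21, q10, q11⟩ := r4 i j k l
    refine exponent_cases hle ?_ ?_ ?_ ?_ ?_ ?_ ?_ ?_ ?_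
    · by_contra hi
      obtain ⟨rfl, rfl⟩ | ⟨rfl, rfl⟩ | ⟨rfl, rfl⟩ :
        (i = 4 ∧ j = 0) ∨ (i = 3 ∧ j = 0) ∨ (i = 3 ∧ j = 1) := by omega
      exacts [hne x40, hne x30, hne x31]
    · rintro rfl
      by_contra hj
      obtain rfl | rfl : j = 0 ∨ j = 1 := by omega
      exacts [hne x20, hne x21]
    · rintro rfl hj
      by_contra h
      have h22 := hd 2 2 k l m n (by omega)
      rw [h22] at x10 x11
      obtain rfl | rfl : j = 0 ∨ j = 1 := by omega
      exacts [hne x10, hne (x11.trans (mul_zero _))]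
    · by_contra hk
      obtain ⟨rfl, rfl⟩ | ⟨rfl, rfl⟩ | ⟨rfl, rfl⟩ :
        (k = 4 ∧ l = 0) ∨ (k = 3 ∧ l = 0) ∨ (k = 3 ∧ l = 1) := by omega
      exacts [hne z40, hne z30, hne z31]
    · rintro rfl
      by_contra hl
      obtain rfl : l = 0 := by omega
      exact hne z20
    · rintro rfl rfl
      by_contra h
      rw [hd i j 2 1 m n (by omega), mul_zero] at z10
      exact hne z10
    · by_contra hm
      obtain ⟨rfl, rfl⟩ | ⟨rfl, rfl⟩ | ⟨rfl, rfl⟩ :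
        (m = 4 ∧ n = 0) ∨ (m = 3 ∧ n = 0) ∨ (m = 3 ∧ n = 1) := by omega
      exacts [hne q40, hne q30, hne q31]
    · rintro rfl
      by_contra hn
      obtain rfl | rfl : n = 0 ∨ n = 1 := by omega
      exacts [hne q20, hne q21]
    · rintro rfl hn
      by_contra h
      have h0 : expo i j k l 0 0 ≠ 0 := by
        intro h0
        rw [eq_expo 0, expo_inj] at h0
        simp only [Finsupp.coe_zero, Pi.zero_apply] at h0
        omega
      rw [hd i j k l 2 2 (by omega), mul_zero] at q10 q11
      rw [if_neg h0, sub_zero] at q11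
      obtain rfl | rfl : n = 0 ∨ n = 1 := by omega
      exacts [hne q10, hne q11])
  refine ⟨H.coeff (expo 2 2 0 0 0 0), H.coeff (expo 0 0 2 2 0 0), H.coeff (expo 0 0 0 0 2 2),
    H.coeff (expo 0 0 2 1 0 0), H.coeff (expo 0 1 2 1 0 0), H.coeff (expo 0 0 2 1 0 1),
    H.coeff (expo 1 2 0 0 0 0), H.coeff (expo 1 3 0 0 0 0), H.coeff (expo 1 2 0 1 0 0),
    H.coeff (expo 1 2 0 0 0 1),
    H.coeff (expo 0 0 0 0 1 2), H.coeff (expo 0 0 0 0 1 3), H.coeff (expo 0 1 0 0 1 2),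
    H.coeff (expo 0 0 0 1 1 2), P, N, ?_⟩
  have hz : expo 0 0 0 0 0 0 = 0 := (eq_expo 0).symm
  conv_lhs => rw [hPN]
  simp only [specialExponents, List.map_cons, List.map_nil, List.sum_cons, List.sum_nil,
    (r0 0 0 0 0).2.2.2.2.2.1, (r0 0 0 0 0).2.2.2.2.2.2,
    (r2 0 0 0 0).2.2.2.2, (r2 0 1 0 0).2.2.2.2, (r2 0 0 0 1).2.2.2.2,
    (r4 0 0 0 0).2.2.2.2.2.1, (r4 0 0 0 0).2.2.2.2.2.2, hz, if_true,
    monomial_expo, map_mul, map_sub, map_neg, map_ofNat]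
  ring

/-! ### The chart r₁: y tends to infinity with w + y fixed -/

/-- The point is the inverse image under r₁ of (ξ, τ, z, w, q, p): y = 1/τ, the old w is w - 1/τ,
and (x - z)y - a = -ξτ gives x. -/
theorem inv_chart1_mem_regular {α : Fin 5 → ℂ} {H K : PhasePoly} (h : BecomesSystemOf H (chart1 α) K)
    {a : RatFunc ℂ} (ha : a = algebraMap ℂ (RatFunc ℂ) (α 1))
    {R : Type} [CommRing R] [IsDomain R] [Algebra (RatFunc ℂ) R]
    {ξ z w q p : RatF R} (hξ : ξ ∈ regular R) (hz : z ∈ regular R) (hw : w ∈ regular R)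
    (hq : q ∈ regular R) (hp : p ∈ regular R) :
    MvPolynomial.aeval ![z + algebraMap _ _ a * tau R - ξ * tau R ^ 2, (tau R)⁻¹, z,
      w - (tau R)⁻¹, q, p] H ∈ regular R := by
  obtain ⟨c, hc⟩ := h.chart1_apply ha
  have hτ := tau_ne_zero (R := R)
  rw [← sub_eq_iff_eq_add.mpr (hc (RatF R) _ _ _ _ _ _ (tau R)
    (inv_mul_cancel₀ (G₀ := RatF R) hτ))]
  refine sub_mem (aeval_mem_subalgebra (fun r => ?_) K) (Subalgebra.algebraMap_mem _ _)
  have h3 : ∀ r : Fin 6, ![ξ, tau R, z, w, q, p] r ∈ regular R := by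
    intro r
    fin_cases r
    exacts [hξ, tau_mem, hz, hw, hq, hp]
  convert h3 r using 3
  · field_simp
    ring
  · ring_nf

/-- Polar parts, for `y = σ → ∞`, of a Hamiltonian in the coordinates inverse to `r₁`. -/
theorem polar_parts_chart1 {L : Type*} [CommRing L] (S : Subring L)
    {τ σ W p A B A' g₀ g₁ g₂ c₀ c₁ c₂ c₃ d₀ d₁ d₂ d₃ a₀ a₁ a₂ a₄ t t' n π : L} (hτσ : τ * σ = 1)
    (hτ : τ ∈ S) (hW : W ∈ S) (hp : p ∈ S) (hA : A ∈ S) (hB : B ∈ S) (hA' : A' ∈ S) (hg₀ : g₀ ∈ S)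
    (hg₂ : g₂ ∈ S) (hc₀ : c₀ ∈ S) (hc₂ : c₂ ∈ S) (hc₃ : c₃ ∈ S) (hd₀ : d₀ ∈ S) (hd₁ : d₁ ∈ S)
    (hd₃ : d₃ ∈ S) (ha₀ : a₀ ∈ S) (ha₁ : a₁ ∈ S) (ha₄ : a₄ ∈ S) (ht : t ∈ S) (ht' : t' ∈ S)
    (h : ∀ ξ z q x : L, ξ ∈ S → z ∈ S → q ∈ S → x = z + a₁ * τ - ξ * τ ^ 2 →
      A * (x ^ 2 * σ ^ 2 + 2 * a₀ * x * σ + x)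
        + B * z ^ 2 * (W - σ) ^ 2
        + (z ^ 2 * (W - σ) + a₂ * z) * (g₀ + g₁ * σ + g₂ * p)
        + x * σ ^ 2 * (c₀ + c₁ * σ + c₂ * (W - σ) + c₃ * p)
        + A' * (q ^ 2 * p ^ 2 + 2 * a₄ * q * p - t * q) - t' * q * p
        + q * p ^ 2 * (d₀ + d₁ * p + d₂ * σ + d₃ * (W - σ))
        + z * (W - σ) * n + π ∈ S) :
    (c₂ - c₁) * σ ∈ S ∧ p ^ 2 * (d₂ - d₃) * σ ∈ S ∧
    2 * (W * (g₁ - 2 * B) - g₀ - p * g₂) * σ + 2 * (A + B - g₁) * σ ^ 2 ∈ S ∧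
    2 * (2 * (a₀ + a₁) * A * σ + a₂ * (g₀ + g₁ * σ + g₂ * p)
      + σ ^ 2 * (c₀ + c₁ * σ + c₂ * (W - σ) + c₃ * p) + (W - σ) * n) ∈ S ∧
    a₁ * σ * (c₀ + c₁ * σ + c₂ * (W - σ) + c₃ * p) + π ∈ S := by
  -- Since τσ = 1, the products xσ and xσ² can be rewritten so that the genuine powers of σ become
  -- visible.
  have key : ∀ ξ z q : L, ξ ∈ S → z ∈ S → q ∈ S →
      A * ((z * σ + a₁ - ξ * τ) ^ 2 + 2 * a₀ * (z * σ + a₁ - ξ * τ) + (z + a₁ * τ - ξ * τ ^ 2))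
        + B * z ^ 2 * (W - σ) ^ 2
        + (z ^ 2 * (W - σ) + a₂ * z) * (g₀ + g₁ * σ + g₂ * p)
        + (z * σ ^ 2 + a₁ * σ - ξ) * (c₀ + c₁ * σ + c₂ * (W - σ) + c₃ * p)
        + A' * (q ^ 2 * p ^ 2 + 2 * a₄ * q * p - t * q) - t' * q * p
        + q * p ^ 2 * (d₀ + d₁ * p + d₂ * σ + d₃ * (W - σ))
        + z * (W - σ) * n + π ∈ S := by
    intro ξ z q hξ hz hq
    have hx : (z + a₁ * τ - ξ * τ ^ 2) * σ = z * σ + a₁ - ξ * τ := by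
      linear_combination (a₁ - ξ * τ) * hτσ
    have hx' : (z * σ + a₁ - ξ * τ) * σ = z * σ ^ 2 + a₁ * σ - ξ := by
      linear_combination -ξ * hτσ
    have := h ξ z q _ hξ hz hq rfl
    rw [← mul_pow, mul_assoc _ _ σ, hx, pow_two σ, ← mul_assoc _ σ σ, hx, hx'] at this
    exact this
  -- The expression is polynomial in ξ, z, q. Differences of its values at 0 and ±1 isolate the
  -- parts in ξ and q, and the even and odd parts in z; the regular terms are then subtracted.
  have m0 := key 0 0 0 S.zero_mem S.zero_mem S.zero_mem
  have mξ := sub_mem (key 1 0 0 S.one_mem S.zero_mem S.zero_mem) m0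
  have mq := sub_mem (key 0 0 1 S.zero_mem S.zero_mem S.one_mem) m0
  have mz := key 0 1 0 S.zero_mem S.one_mem S.zero_mem
  have mz' := key 0 (-1) 0 S.zero_mem (S.neg_mem S.one_mem) S.zero_mem
  have two : (2 : L) ∈ S := ofNat_mem S 2
  refine ⟨?_, ?_, ?_, ?_, ?_⟩
  · have hrest : A * ((a₁ - τ) ^ 2 - a₁ ^ 2 - 2 * a₀ * τ - τ ^ 2) - (c₀ + c₂ * W + c₃ * p) ∈ S := by
      repeat' first
        | assumption
        | refine pow_mem ?_ _
        | refine sub_mem ?_ ?_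
        | refine add_mem ?_ ?_
        | refine mul_mem ?_ ?_
    convert sub_mem mξ hrest using 1
    ring
  · have hrest : A' * (p ^ 2 + 2 * a₄ * p - t) - t' * p + p ^ 2 * (d₀ + d₁ * p + d₃ * W) ∈ S := by
      repeat' first
        | assumption
        | refine pow_mem ?_ _
        | refine sub_mem ?_ ?_
        | refine add_mem ?_ ?_
        | refine mul_mem ?_ ?_
    convert sub_mem mq hrest using 1
    ring
  · have hrest : 2 * (B * W ^ 2 + W * (g₀ + g₂ * p)) ∈ S := by
      repeat' first
        | assumption
        | refine pow_mem ?_ _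
        | refine sub_mem ?_ ?_
        | refine add_mem ?_ ?_
        | refine mul_mem ?_ ?_
    convert sub_mem (sub_mem (add_mem mz mz') (add_mem m0 m0)) hrest using 1
    ring
  · convert sub_mem (sub_mem mz mz') (mul_mem two hA) using 1
    ring
  · have hrest : A * (a₁ ^ 2 + 2 * a₀ * a₁ + a₁ * τ) ∈ S := by
      repeat' first
        | assumption
        | refine pow_mem ?_ _
        | refine sub_mem ?_ ?_
        | refine add_mem ?_ ?_
        | refine mul_mem ?_ ?_
    convert sub_mem m0 hrest using 1
    ring

theorem exists_eq_C_of_aeval_inv_mem {R : Type*} [CommRing R] [IsDomain R]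
    [Algebra (RatFunc ℂ) R] {f : Polynomial R}
    (h : Polynomial.aeval (tau R)⁻¹ f ∈ regular R) : ∃ r, f = Polynomial.C r := by
  refine ⟨f.coeff 0, Polynomial.ext fun n => ?_⟩
  rcases eq_or_ne n 0 with rfl | hn
  · simp
  · rw [coeff_eq_zero_of_aeval_inv_mem h hn, Polynomial.coeff_C, if_neg hn]

/-- `ℂ(t)[W, p]`. -/
abbrev BiPoly : Type := MvPolynomial (Fin 2) (RatFunc ℂ)

set_option maxHeartbeats 2000000 in
open MvPolynomial in
/-- The shape that the charts `r₀`, `r₁`, `r₂`, `r₄` impose on a Hamiltonian of degree at most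
four. -/
theorem exists_shape_of_charts₀₁₂₄ {α : Fin 5 → ℂ} {H K₀ K₁ K₂ K₄ : PhasePoly}
    (hH : H.totalDegree ≤ 4)
    (h0 : BecomesSystemOf H (chart0 α) K₀) (h1 : BecomesSystemOf H (chart1 α) K₁)
    (h2 : BecomesSystemOf H (chart2 α) K₂)
    (h4 : BecomesSystemOf H (chart4 α) K₄) {a₀ a₁ a₂ a₄ : RatFunc ℂ}
    (ha₀ : a₀ = algebraMap ℂ (RatFunc ℂ) (α 0)) (ha₁ : a₁ = algebraMap ℂ (RatFunc ℂ) (α 1))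
    (ha₂ : a₂ = algebraMap ℂ (RatFunc ℂ) (α 2)) (ha₄ : a₄ = algebraMap ℂ (RatFunc ℂ) (α 4)) :
    ∃ (A A' c₀ c₁ c₃ d₀ d₁ d₂ : RatFunc ℂ) (μ : MvPolynomial (Fin 2) (RatFunc ℂ)),
      H = C A * (X 0 ^ 2 * X 1 ^ 2 + 2 * C a₀ * X 0 * X 1 + X 0)
        + C A * X 2 ^ 2 * X 3 ^ 2 + 2 * C A * (X 2 ^ 2 * X 3 + C a₂ * X 2) * X 1
        + 2 * C A * C (a₀ + a₁ + a₂) * X 2 * X 3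
        + (X 0 * X 1 ^ 2 + X 2 * (2 * X 1 * X 3 + X 3 ^ 2) - C a₁ * X 1)
          * (C c₀ + C c₁ * (X 1 + X 3) + C c₃ * X 5)
        + C A' * (X 4 ^ 2 * X 5 ^ 2 + 2 * C a₄ * X 4 * X 5 - C RatFunc.X * X 4)
        - C (1 / RatFunc.X) * X 4 * X 5
        + X 4 * X 5 ^ 2 * (C d₀ + C d₁ * X 5 + C d₂ * (X 1 + X 3))
        + aeval ![X 1 + X 3, X 5] μ := by
  obtain ⟨A, B, A', g₀, g₁, g₂, c₀, c₁, c₂, c₃, d₀, d₁, d₂, d₃, P, N, hshape⟩ :=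
    exists_shape_of_charts₀₂₄ hH h0 h2 h4 ha₀ ha₂ ha₄
  -- W = w + y and p are kept as indeterminates of the base ring, so one pole condition yields
  -- identities between polynomials in W and p.
  let ι : RatFunc ℂ → RatF BiPoly := algebraMap (RatFunc ℂ) (RatF BiPoly)
  have hι : ∀ r : RatFunc ℂ, algebraMap BiPoly (RatF BiPoly) (C r) = ι r := fun r => rfl
  let W : RatF BiPoly := algebraMap BiPoly (RatF BiPoly) (X 0)
  let p : RatF BiPoly := algebraMap BiPoly (RatF BiPoly) (X 1)
  let n : RatF BiPoly := aeval ![(tau BiPoly)⁻¹, W - (tau BiPoly)⁻¹, p] N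
  let π : RatF BiPoly := aeval ![(tau BiPoly)⁻¹, W - (tau BiPoly)⁻¹, p] P
  have hτ := tau_ne_zero (R := BiPoly)
  have hval : ∀ x z q : RatF BiPoly, aeval ![x, (tau BiPoly)⁻¹, z, W - (tau BiPoly)⁻¹, q, p] H
      = ι A * (x ^ 2 * (tau BiPoly)⁻¹ ^ 2 + 2 * ι a₀ * x * (tau BiPoly)⁻¹ + x)
        + ι B * z ^ 2 * (W - (tau BiPoly)⁻¹) ^ 2
        + (z ^ 2 * (W - (tau BiPoly)⁻¹) + ι a₂ * z) * (ι g₀ + ι g₁ * (tau BiPoly)⁻¹ + ι g₂ * p)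
        + x * (tau BiPoly)⁻¹ ^ 2 * (ι c₀ + ι c₁ * (tau BiPoly)⁻¹ + ι c₂ * (W - (tau BiPoly)⁻¹) + ι c₃ * p)
        + ι A' * (q ^ 2 * p ^ 2 + 2 * ι a₄ * q * p - ι RatFunc.X * q)
        - ι (1 / RatFunc.X) * q * p
        + q * p ^ 2 * (ι d₀ + ι d₁ * p + ι d₂ * (tau BiPoly)⁻¹ + ι d₃ * (W - (tau BiPoly)⁻¹))
        + z * (W - (tau BiPoly)⁻¹) * n + π := by
    intro x z q
    rw [hshape]
    simp only [map_add, map_sub, map_mul, map_pow, map_ofNat, aeval_C, aeval_X, comp_aeval_apply,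
      Matrix.cons_val]
    have hv : (fun i : Fin 3 => aeval ![x, (tau BiPoly)⁻¹, z, W - (tau BiPoly)⁻¹, q, p]
        ((![X 1, X 3, X 5] : Fin 3 → PhasePoly) i)) = ![(tau BiPoly)⁻¹, W - (tau BiPoly)⁻¹, p] := by
      ext1 i
      fin_cases i <;> simp
    rw [hv]
  have hιmem : ∀ r, ι r ∈ (regular BiPoly).toSubring := fun r => algebraMap_mem_regular (C r)
  have hWmem : W ∈ (regular BiPoly).toSubring := algebraMap_mem_regular _
  have hpmem : p ∈ (regular BiPoly).toSubring := algebraMap_mem_regular _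
  obtain ⟨polar_x, polar_q, polar_z₂, polar_z, polar_one⟩ := polar_parts_chart1 (regular BiPoly).toSubring
    (mul_inv_cancel₀ (G₀ := RatF BiPoly) hτ) tau_mem hWmem hpmem (hιmem A) (hιmem B) (hιmem A') (hιmem g₀)
    (hιmem g₂) (hιmem c₀) (hιmem c₂) (hιmem c₃) (hιmem d₀) (hιmem d₁) (hιmem d₃) (hιmem a₀)
    (hιmem a₁) (hιmem a₄) (hιmem RatFunc.X) (hιmem (1 / RatFunc.X))
    (a₂ := ι a₂) (g₁ := ι g₁) (c₁ := ι c₁) (d₂ := ι d₂) (n := n) (π := π)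
    (by
      rintro ξ z q x hξ hz hq rfl
      rw [← hval]
      exact inv_chart1_mem_regular h1 ha₁ hξ hz hWmem hq hpmem)
  have hc : c₂ = c₁ := by
    have := eq_zero_of_sum_inv_mem (R := BiPoly) (e := ![C (c₂ - c₁)]) (by
      convert polar_x using 1
      simp [hι, ι]) 0
    have := congrArg (eval ![0, 0]) this
    simpa [sub_eq_zero] using this
  have hd : d₃ = d₂ := by
    have := eq_zero_of_sum_inv_mem (R := BiPoly) (e := ![X 1 ^ 2 * C (d₂ - d₃)]) (by
      convert polar_q using 1
      simp [hι, ι, p]) 0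
    have := congrArg (eval ![0, 1]) this
    simpa [sub_eq_zero, eq_comm] using this
  have hquad := eq_zero_of_sum_inv_mem (R := BiPoly)
    (e := ![2 * (X 0 * C (g₁ - 2 * B) - C g₀ - X 1 * C g₂), 2 * C (A + B - g₁)]) (by
      convert polar_z₂ using 1
      simp only [Fin.sum_univ_two, Matrix.cons_val_zero, Matrix.cons_val_one, Fin.val_zero,
        Fin.val_one, zero_add, pow_one, hι, map_mul, map_sub, map_ofNat]
      simp [ι, W, p])
  have hg₀ : g₀ = 0 := by
    have := congrArg (eval ![0, 0]) (hquad 0)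
    simpa using this
  have hg₁ : g₁ = 2 * B := by
    have := congrArg (eval ![1, 0]) (hquad 0)
    simpa [hg₀, sub_eq_zero] using this
  have hg₂ : g₂ = 0 := by
    have := congrArg (eval ![0, 1]) (hquad 0)
    simpa [hg₀] using this
  have hB : B = A := by
    have := congrArg (eval ![0, 0]) (hquad 1)
    simp [hg₁] at this
    linear_combination -this
  subst hc hd hg₀ hg₁ hg₂ hB
  -- Substituting w = W - y turns N and P into polynomials in y over ℂ(t)[W, p]. Regularity at y =
  -- 1/τ will force suitable combinations to be constant in y.
  let lift : MvPolynomial (Fin 3) (RatFunc ℂ) → Polynomial BiPoly :=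
    aeval ![Polynomial.X, Polynomial.C (X 0) - Polynomial.X, Polynomial.C (X 1)]
  have hlift : ∀ Q : MvPolynomial (Fin 3) (RatFunc ℂ), Polynomial.aeval (tau BiPoly)⁻¹ (lift Q)
      = aeval ![(tau BiPoly)⁻¹, W - (tau BiPoly)⁻¹, p] Q := by
    intro Q
    change ((Polynomial.aeval (tau BiPoly)⁻¹).restrictScalars (RatFunc ℂ)) (aeval _ Q) = _
    rw [comp_aeval_apply]
    congr 2
    ext1 i
    fin_cases i <;> simp [W, p]
  have hliftN : Polynomial.aeval (tau BiPoly)⁻¹ (lift N) = n := hlift N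
  have hliftP : Polynomial.aeval (tau BiPoly)⁻¹ (lift P) = π := hlift P
  -- `Θ` evaluates at chosen values of y, W, p, carrying identities over ℂ(t)[W, p][y] back to phase
  -- space with W = y + w.
  let Θ : ∀ (S : Type) [CommRing S] [Algebra (RatFunc ℂ) S] (_ _ _ : S),
      Polynomial BiPoly →ₐ[RatFunc ℂ] S := fun S _ _ y u v =>
    Polynomial.eval₂AlgHom (aeval ![u, v]) y (fun _ => Commute.all _ _)
  have hΘX : ∀ (S : Type) [CommRing S] [Algebra (RatFunc ℂ) S] (y u v : S),
      Θ S y u v Polynomial.X = y := fun S _ _ y u v => by simp [Θ]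
  have hΘC : ∀ (S : Type) [CommRing S] [Algebra (RatFunc ℂ) S] (y u v : S) (r : BiPoly),
      Θ S y u v (Polynomial.C r) = aeval ![u, v] r := fun S _ _ y u v r => by simp [Θ]
  have hΘlift : ∀ (S : Type) [CommRing S] [Algebra (RatFunc ℂ) S] (y u v : S) (Q),
      Θ S y u v (lift Q) = aeval ![y, u - y, v] Q := by
    intro S _ _ y u v Q
    change Θ S y u v (aeval _ Q) = _
    rw [comp_aeval_apply]
    congr 2
    ext1 i
    fin_cases i <;> simp [hΘX, hΘC]
  let ℓ : Polynomial BiPoly := Polynomial.C (C c₀ + C c₂ * X 0 + C c₃ * X 1)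
  let cc : RatFunc ℂ → Polynomial BiPoly := fun r => Polynomial.C (C r)
  have hcc : ∀ r, Polynomial.aeval (tau BiPoly)⁻¹ (cc r) = ι r := fun r => by simp [cc, ← hι]
  have hΘcc : ∀ (S : Type) [CommRing S] [Algebra (RatFunc ℂ) S] (y u v : S) (r : RatFunc ℂ),
      Θ S y u v (cc r) = algebraMap _ S r := fun S _ _ y u v r => by simp [hΘC, cc]
  have hℓ : Polynomial.aeval (tau BiPoly)⁻¹ ℓ = ι c₀ + ι c₂ * W + ι c₃ * p := by
    simp [ℓ, W, p, ← hι]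
  have hΘℓ : ∀ (S : Type) [CommRing S] [Algebra (RatFunc ℂ) S] (y u v : S),
      Θ S y u v ℓ = algebraMap _ S c₀ + algebraMap _ S c₂ * u + algebraMap _ S c₃ * v :=
    fun S _ _ y u v => by simp [hΘC, ℓ]
  obtain ⟨ν, hν⟩ : ∃ ν : BiPoly, cc (2 * (a₀ + a₁ + a₂) * B) * Polynomial.X + Polynomial.X ^ 2 * ℓ
      + (Polynomial.C (X 0) - Polynomial.X) * lift N = Polynomial.C ν := by
    refine exists_eq_C_of_aeval_inv_mem ?_
    change _ ∈ (regular BiPoly).toSubring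
    have htwo : ι (1 / 2) ∈ (regular BiPoly).toSubring := hιmem _
    convert mul_mem htwo polar_z using 1
    have h2 : ι (1 / 2) * 2 = 1 := by
      rw [← map_ofNat (algebraMap (RatFunc ℂ) (RatF BiPoly)) 2]
      simp only [ι, ← map_mul]
      norm_num
    simp only [map_add, map_mul, map_sub, map_pow, hcc, Polynomial.aeval_X, hℓ, hliftN,
      Polynomial.aeval_C]
    rw [← mul_assoc, h2, one_mul]
    simp only [ι, map_add, map_mul, map_zero, map_ofNat]
    ring
  obtain ⟨μ, hμ⟩ : ∃ μ : BiPoly, cc a₁ * Polynomial.X * ℓ + lift P = Polynomial.C μ := by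
    refine exists_eq_C_of_aeval_inv_mem ?_
    change _ ∈ (regular BiPoly).toSubring
    convert polar_one using 1
    simp only [map_add, map_mul, hcc, Polynomial.aeval_X, hℓ, hliftP]
    ring
  have hN := congrArg (Θ PhasePoly (X 1) (X 1 + X 3) (X 5)) hν
  have hP := congrArg (Θ PhasePoly (X 1) (X 1 + X 3) (X 5)) hμ
  -- At y = W the factor W - y in front of N vanishes, so this evaluation computes `ν`. Reinserting
  -- it gives wN explicitly.
  have hνval := congrArg (Θ BiPoly (X 0) (X 0) (X 1)) hν
  have hX : (fun i : Fin 2 => (![X 0, X 1] : Fin 2 → BiPoly) i) = X := by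
    ext1 i
    fin_cases i <;> rfl
  simp only [map_add, map_mul, map_sub, map_pow, hΘcc, hΘX, hΘC, hΘℓ, hΘlift] at hN hP hνval
  simp only [aeval_X, Matrix.cons_val, sub_self, zero_mul, add_zero] at hN hP hνval
  rw [show (![X 0, X 1] : Fin 2 → BiPoly) = X from hX, aeval_X_left_apply] at hνval
  rw [← hνval] at hN
  simp only [map_add, map_mul, map_pow, aeval_X, Matrix.cons_val, add_sub_cancel_left,
    AlgHom.commutes, map_ofNat] at hN hP
  refine ⟨B, A', c₀, c₂, c₃, d₀, d₁, d₃, μ, ?_⟩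
  rw [hshape, ← hP]
  simp only [MvPolynomial.algebraMap_eq, map_add, map_mul, map_zero, map_ofNat] at hN ⊢
  linear_combination X 2 * hN

/-! ### The composite of r₂ and r₃ -/

/-- The point has r₃-coordinates z₃ = 0, w₃ = τ, q₃ = Z - a₃τ, p₃ = 0. Going back through r₃ gives
z₂ = Z, w₂ = 1/τ, p₂ = -1/τ, and r₂ then gives z and w. Only Z ≠ 0 is needed; 1/Z need not be
regular. -/
theorem inv_chart₂₃_mem_regular {α : Fin 5 → ℂ} {H K₂ K₃ : PhasePoly}
    (h₂ : BecomesSystemOf H (chart2 α) K₂) (h₃ : BecomesSystemOf K₂ (chart3 α) K₃)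
    {a₂ a₃ : RatFunc ℂ} (ha₂ : a₂ = algebraMap ℂ (RatFunc ℂ) (α 2))
    (ha₃ : a₃ = algebraMap ℂ (RatFunc ℂ) (α 3))
    {R : Type} [CommRing R] [IsDomain R] [Algebra (RatFunc ℂ) R]
    {x y Z : RatF R} (hx : x ∈ regular R) (hy : y ∈ regular R) (hZ : Z ∈ regular R) (hZ0 : Z ≠ 0) :
    MvPolynomial.aeval ![x, y, Z⁻¹, -((tau R)⁻¹ * Z + algebraMap _ _ a₂) * Z,
      Z - algebraMap _ _ a₃ * tau R, -(tau R)⁻¹] H ∈ regular R := by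
  obtain ⟨c, hc⟩ := h₂.chart2_apply ha₂
  obtain ⟨c', hc'⟩ := h₃.chart3_apply ha₃
  have hτ := tau_ne_zero (R := R)
  have e₂ := hc (RatF R) x y Z⁻¹ (-((tau R)⁻¹ * Z + algebraMap _ _ a₂) * Z)
    (Z - algebraMap _ _ a₃ * tau R) (-(tau R)⁻¹) Z (inv_mul_cancel₀ (G₀ := RatF R) hZ0)
  have e₃ := hc' (RatF R) x y Z (tau R)⁻¹
    (Z - algebraMap _ _ a₃ * tau R) (-(tau R)⁻¹) (tau R) (inv_mul_cancel₀ (G₀ := RatF R) hτ)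
  have hw : -(-((tau R)⁻¹ * Z + algebraMap _ _ a₂) * Z * Z⁻¹ + algebraMap _ (RatF R) a₂) * Z⁻¹
      = (tau R)⁻¹ := by
    field_simp
    ring
  rw [hw] at e₂
  rw [← sub_eq_iff_eq_add.mpr e₂, ← sub_eq_iff_eq_add.mpr e₃]
  refine sub_mem (sub_mem (aeval_mem_subalgebra (fun r => ?_) K₃) (Subalgebra.algebraMap_mem _ _))
    (Subalgebra.algebraMap_mem _ _)
  have h3 : ∀ r : Fin 6, ![x, y, 0, tau R, Z - algebraMap _ _ a₃ * tau R, 0] r ∈ regular R := by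
    intro r
    fin_cases r
    exacts [hx, hy, zero_mem _, tau_mem,
      sub_mem hZ (mul_mem (Subalgebra.algebraMap_mem _ _) tau_mem), zero_mem _]
  convert h3 r using 3
  field_simp
  ring_nf

/-- The negative powers of Z cancel, leaving 1/τ as the only source of poles when Z lies in R[τ]. -/
theorem shape_chart₂₃ {L : Type*} [Field L] {τ x y Z A A' c₀ c₁ c₃ d₀ d₁ d₂ a₀ a₁ a₂ a₃ a₄ s t t' m : L}
    (hτ : τ ≠ 0) (hZ : Z ≠ 0) :
    A * (x ^ 2 * y ^ 2 + 2 * a₀ * x * y + x)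
        + A * Z⁻¹ ^ 2 * (-(τ⁻¹ * Z + a₂) * Z) ^ 2
        + 2 * A * (Z⁻¹ ^ 2 * (-(τ⁻¹ * Z + a₂) * Z) + a₂ * Z⁻¹) * y
        + 2 * A * s * Z⁻¹ * (-(τ⁻¹ * Z + a₂) * Z)
        + (x * y ^ 2 + Z⁻¹ * (2 * y * (-(τ⁻¹ * Z + a₂) * Z) + (-(τ⁻¹ * Z + a₂) * Z) ^ 2) - a₁ * y)
          * (c₀ + c₁ * (y + -(τ⁻¹ * Z + a₂) * Z) + c₃ * -τ⁻¹)
        + A' * ((Z - a₃ * τ) ^ 2 * (-τ⁻¹) ^ 2 + 2 * a₄ * (Z - a₃ * τ) * -τ⁻¹ - t * (Z - a₃ * τ))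
        - t' * (Z - a₃ * τ) * -τ⁻¹
        + (Z - a₃ * τ) * (-τ⁻¹) ^ 2 * (d₀ + d₁ * -τ⁻¹ + d₂ * (y + -(τ⁻¹ * Z + a₂) * Z)) + m
      = A * (x ^ 2 * y ^ 2 + 2 * a₀ * x * y + x) + A * (τ⁻¹ * Z + a₂) ^ 2 - 2 * A * τ⁻¹ * y
        - 2 * A * s * (τ⁻¹ * Z + a₂)
        + (x * y ^ 2 - 2 * y * (τ⁻¹ * Z + a₂) + (τ⁻¹ * Z + a₂) ^ 2 * Z - a₁ * y)
          * (c₀ + c₁ * (y - (τ⁻¹ * Z + a₂) * Z) - c₃ * τ⁻¹)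
        + A' * ((τ⁻¹ * Z - a₃) ^ 2 - 2 * a₄ * (τ⁻¹ * Z - a₃) - t * (Z - a₃ * τ))
        + t' * (τ⁻¹ * Z - a₃)
        + (τ⁻¹ * Z - a₃) * τ⁻¹ * (d₀ - d₁ * τ⁻¹ + d₂ * (y - (τ⁻¹ * Z + a₂) * Z)) + m := by
  field_simp
  ring

open MvPolynomial in
theorem shape_mem_regular {α : Fin 5 → ℂ} {H K₂ K₃ : PhasePoly}
    (h₂ : BecomesSystemOf H (chart2 α) K₂) (h₃ : BecomesSystemOf K₂ (chart3 α) K₃)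
    {a₀ a₁ a₂ a₃ a₄ : RatFunc ℂ} (ha₂ : a₂ = algebraMap ℂ (RatFunc ℂ) (α 2))
    (ha₃ : a₃ = algebraMap ℂ (RatFunc ℂ) (α 3))
    {A A' c₀ c₁ c₃ d₀ d₁ d₂ s t t' : RatFunc ℂ} {μ : BiPoly}
    (hH : H = C A * (X 0 ^ 2 * X 1 ^ 2 + 2 * C a₀ * X 0 * X 1 + X 0)
        + C A * X 2 ^ 2 * X 3 ^ 2 + 2 * C A * (X 2 ^ 2 * X 3 + C a₂ * X 2) * X 1
        + 2 * C A * C s * X 2 * X 3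
        + (X 0 * X 1 ^ 2 + X 2 * (2 * X 1 * X 3 + X 3 ^ 2) - C a₁ * X 1)
          * (C c₀ + C c₁ * (X 1 + X 3) + C c₃ * X 5)
        + C A' * (X 4 ^ 2 * X 5 ^ 2 + 2 * C a₄ * X 4 * X 5 - C t * X 4)
        - C t' * X 4 * X 5
        + X 4 * X 5 ^ 2 * (C d₀ + C d₁ * X 5 + C d₂ * (X 1 + X 3))
        + aeval ![X 1 + X 3, X 5] μ)
    {R : Type} [CommRing R] [IsDomain R] [Algebra (RatFunc ℂ) R] {ι : RatFunc ℂ →+* RatF R}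
    (hι : ι = algebraMap (RatFunc ℂ) (RatF R))
    {x y Z : RatF R} (hx : x ∈ regular R) (hy : y ∈ regular R) (hZ : Z ∈ regular R) (hZ0 : Z ≠ 0) :
    ι A * (x ^ 2 * y ^ 2 + 2 * ι a₀ * x * y + x) + ι A * ((tau R)⁻¹ * Z + ι a₂) ^ 2
        - 2 * ι A * (tau R)⁻¹ * y - 2 * ι A * ι s * ((tau R)⁻¹ * Z + ι a₂)
        + (x * y ^ 2 - 2 * y * ((tau R)⁻¹ * Z + ι a₂) + ((tau R)⁻¹ * Z + ι a₂) ^ 2 * Z - ι a₁ * y)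
          * (ι c₀ + ι c₁ * (y - ((tau R)⁻¹ * Z + ι a₂) * Z) - ι c₃ * (tau R)⁻¹)
        + ι A' * (((tau R)⁻¹ * Z - ι a₃) ^ 2 - 2 * ι a₄ * ((tau R)⁻¹ * Z - ι a₃)
          - ι t * (Z - ι a₃ * tau R))
        + ι t' * ((tau R)⁻¹ * Z - ι a₃)
        + ((tau R)⁻¹ * Z - ι a₃) * (tau R)⁻¹
          * (ι d₀ - ι d₁ * (tau R)⁻¹ + ι d₂ * (y - ((tau R)⁻¹ * Z + ι a₂) * Z))
        + aeval ![y - ((tau R)⁻¹ * Z + ι a₂) * Z, -(tau R)⁻¹] μ ∈ regular R := by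
  have := inv_chart₂₃_mem_regular h₂ h₃ ha₂ ha₃ hx hy hZ hZ0
  rw [hH] at this
  simp only [map_add, map_sub, map_mul, map_pow, map_ofNat, aeval_C, aeval_X, comp_aeval_apply,
      Matrix.cons_val, ← hι] at this
  rw [shape_chart₂₃ tau_ne_zero hZ0] at this
  convert this using 4
  ext1 i
  fin_cases i
  · simp
    ring
  · simp

open MvPolynomial in
/-- The chart `r₃` over `r₂` forces the terms linear in `x y²` to vanish. -/
theorem linear_terms_eq_zero {A A' a₀ a₁ a₂ a₃ a₄ c₀ c₁ c₃ d₀ d₁ d₂ s t t' : RatFunc ℂ} {μ : BiPoly}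
    {ι : RatFunc ℂ →+* RatF (RatFunc ℂ)} (hι : ι = algebraMap (RatFunc ℂ) (RatF (RatFunc ℂ)))
    {σ τ : RatF (RatFunc ℂ)} (hσ : σ = (tau (RatFunc ℂ))⁻¹)
    (h : ∀ x y Z : RatF (RatFunc ℂ), x ∈ regular (RatFunc ℂ) → y ∈ regular (RatFunc ℂ) →
      Z ∈ regular (RatFunc ℂ) → Z ≠ 0 →
      ι A * (x ^ 2 * y ^ 2 + 2 * ι a₀ * x * y + x) + ι A * (σ * Z + ι a₂) ^ 2
        - 2 * ι A * σ * y - 2 * ι A * ι s * (σ * Z + ι a₂)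
        + (x * y ^ 2 - 2 * y * (σ * Z + ι a₂) + (σ * Z + ι a₂) ^ 2 * Z - ι a₁ * y)
          * (ι c₀ + ι c₁ * (y - (σ * Z + ι a₂) * Z) - ι c₃ * σ)
        + ι A' * ((σ * Z - ι a₃) ^ 2 - 2 * ι a₄ * (σ * Z - ι a₃)
          - ι t * (Z - ι a₃ * τ))
        + ι t' * (σ * Z - ι a₃)
        + (σ * Z - ι a₃) * σ
          * (ι d₀ - ι d₁ * σ + ι d₂ * (y - (σ * Z + ι a₂) * Z))
        + aeval ![y - (σ * Z + ι a₂) * Z, -σ] μ ∈ regular (RatFunc ℂ)) :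
    c₁ = 0 ∧ c₃ = 0 := by
  have hιmem : ∀ r, ι r ∈ regular (RatFunc ℂ) := fun r => hι ▸ algebraMap_mem_regular r
  -- With y = 1 and Z = n, the difference between x = 1 and x = 0 has polar part -(c₁n² + c₃)/τ. The
  -- values n = 1 and n = 2 separate c₁ from c₃.
  have key : ∀ n : RatFunc ℂ, n ≠ 0 → c₁ * n ^ 2 + c₃ = 0 := by
    intro n hn
    have hn0 : ι n ≠ 0 := by simpa using hn
    have hrest : ι A * (1 + 2 * ι a₀ + 1) + (ι c₀ + ι c₁ * (1 - ι a₂ * ι n)) ∈ regular (RatFunc ℂ) := by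
      repeat' first
        | exact hιmem _
        | exact one_mem _
        | exact ofNat_mem _ 2
        | refine sub_mem ?_ ?_
        | refine add_mem ?_ ?_
        | refine mul_mem ?_ ?_
    have := eq_zero_of_sum_inv_mem (R := RatFunc ℂ) (e := ![-(c₁ * n ^ 2 + c₃)]) (by
      convert sub_mem (sub_mem (h 1 1 (ι n) (one_mem _) (one_mem _) (hιmem n) hn0)
        (h 0 1 (ι n) (zero_mem _) (one_mem _) (hιmem n) hn0)) hrest using 1
      simp only [Fin.sum_univ_one, Matrix.cons_val_zero, Fin.val_zero, zero_add, pow_one, ← hι, ← hσ,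
        map_neg, map_add, map_mul, map_pow]
      ring) 0
    rw [Matrix.cons_val_zero, neg_eq_zero] at this
    exact this
  have k1 := key 1 one_ne_zero
  have k2 := key 2 two_ne_zero
  have h1 : c₁ = 0 := by linear_combination (k2 - k1) / 3
  exact ⟨h1, by linear_combination k1 - h1⟩

open MvPolynomial in
/-- The chart `r₃` over `r₂` determines the dependence of `μ` on `p`. -/
theorem exists_eq_of_shape_mem {A A' a₁ a₂ a₃ a₄ c₀ d₀ d₁ d₂ s t t' : RatFunc ℂ} {μ : BiPoly}
    {ι : RatFunc ℂ →+* RatF (Polynomial (RatFunc ℂ))}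
    (hι : ι = algebraMap (RatFunc ℂ) (RatF (Polynomial (RatFunc ℂ))))
    {σ τ : RatF (Polynomial (RatFunc ℂ))} (hσ : σ = (tau (Polynomial (RatFunc ℂ)))⁻¹)
    (hτ : τ = tau (Polynomial (RatFunc ℂ)))
    (h : ∀ y Z : RatF (Polynomial (RatFunc ℂ)), y ∈ regular (Polynomial (RatFunc ℂ)) →
      Z ∈ regular (Polynomial (RatFunc ℂ)) → Z ≠ 0 →
      ι A * (σ * Z + ι a₂) ^ 2
        - 2 * ι A * σ * y - 2 * ι A * ι s * (σ * Z + ι a₂)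
        + (-2 * y * (σ * Z + ι a₂) + (σ * Z + ι a₂) ^ 2 * Z - ι a₁ * y) * ι c₀
        + ι A' * ((σ * Z - ι a₃) ^ 2 - 2 * ι a₄ * (σ * Z - ι a₃)
          - ι t * (Z - ι a₃ * τ))
        + ι t' * (σ * Z - ι a₃)
        + (σ * Z - ι a₃) * σ
          * (ι d₀ - ι d₁ * σ + ι d₂ * (y - (σ * Z + ι a₂) * Z))
        + aeval ![y - (σ * Z + ι a₂) * Z, -σ] μ ∈ regular (Polynomial (RatFunc ℂ))) :
    ∃ ν : Polynomial (RatFunc ℂ), ∀ (S : Type) [CommRing S] [Algebra (RatFunc ℂ) S] (u p : S),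
      aeval ![u, p] μ = Polynomial.aeval u ν - 2 * algebraMap _ S A * u * p
        + algebraMap _ S (1 - a₃) * p
          * (algebraMap _ S d₀ + algebraMap _ S d₁ * p + algebraMap _ S d₂ * u) := by
  have hιmem : ∀ r, ι r ∈ regular (Polynomial (RatFunc ℂ)) := fun r =>
    hι ▸ algebraMap_mem_regular (Polynomial.C r)
  have hτσ : τ * σ = 1 := by
    rw [hτ, hσ]
    exact mul_inv_cancel₀ (G₀ := RatF (Polynomial (RatFunc ℂ))) tau_ne_zero
  have hτmem : τ ∈ regular (Polynomial (RatFunc ℂ)) := hτ ▸ tau_mem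
  obtain ⟨Y, hY⟩ : ∃ Y, Y = algebraMap _ (RatF (Polynomial (RatFunc ℂ))) (Polynomial.X : Polynomial (RatFunc ℂ)) :=
    ⟨_, rfl⟩
  have hYmem : Y ∈ regular (Polynomial (RatFunc ℂ)) := hY ▸ algebraMap_mem_regular _
  -- With Z = τ one has σZ = 1, and y is chosen so that y + w becomes the indeterminate Y. All
  -- remaining poles come from p = -σ and the explicit factors σ.
  have hmem := h (Y + (1 + ι a₂) * τ) τ
    (add_mem hYmem (mul_mem (add_mem (one_mem _) (hιmem _)) hτmem)) hτmem (hτ ▸ tau_ne_zero)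
  rw [mul_comm σ τ, hτσ, add_sub_cancel_right] at hmem
  let P : Polynomial (Polynomial (RatFunc ℂ)) := Polynomial.X
  let cc : RatFunc ℂ → Polynomial (Polynomial (RatFunc ℂ)) := fun r => Polynomial.C (Polynomial.C r)
  let u : Polynomial (Polynomial (RatFunc ℂ)) := Polynomial.C Polynomial.X
  have hcc : ∀ r, Polynomial.aeval σ (cc r) = ι r := fun r => by
    rw [Polynomial.aeval_C, hι]; rfl
  have hu : Polynomial.aeval σ u = Y := by rw [Polynomial.aeval_C, hY]
  have hμ : Polynomial.aeval σ (aeval ![u, -P] μ) = aeval ![Y, -σ] μ := by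
    change ((Polynomial.aeval σ).restrictScalars (RatFunc ℂ)) (aeval _ μ) = _
    rw [comp_aeval_apply]
    congr 2
    ext1 i
    fin_cases i
    · exact hu
    · simp [P]
  -- `P` stands for σ. The left side collects the polar terms as a polynomial in σ over ℂ(t)[Y];
  -- being regular, it is constant in σ.
  obtain ⟨ν, hν⟩ : ∃ ν, aeval ![u, -P] μ - 2 * cc A * u * P
      + cc (1 - a₃) * P * (cc d₀ - cc d₁ * P + cc d₂ * u) = Polynomial.C ν := by
    refine exists_eq_C_of_aeval_inv_mem ?_
    have hrest : ι A * (1 + ι a₂) ^ 2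
        - 2 * ι A * (1 + ι a₂) - 2 * ι A * ι s * (1 + ι a₂)
        + (-2 * (Y + (1 + ι a₂) * τ) * (1 + ι a₂) + (1 + ι a₂) ^ 2 * τ
          - ι a₁ * (Y + (1 + ι a₂) * τ)) * ι c₀
        + ι A' * ((1 - ι a₃) ^ 2 - 2 * ι a₄ * (1 - ι a₃)
          - ι t * (τ - ι a₃ * τ))
        + ι t' * (1 - ι a₃) ∈ regular (Polynomial (RatFunc ℂ)) := by
      repeat' first
        | exact hιmem _
        | exact one_mem _
        | exact hτmem
        | exact hYmem
        | exact ofNat_mem _ 2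
        | refine neg_mem ?_
        | refine pow_mem ?_ _
        | refine sub_mem ?_ ?_
        | refine add_mem ?_ ?_
        | refine mul_mem ?_ ?_
    rw [← hσ]
    convert sub_mem hmem hrest using 1
    simp only [map_add, map_sub, map_mul, map_ofNat, hμ, hcc, hu, P, Polynomial.aeval_X, map_one]
    linear_combination 2 * ι A * (1 + ι a₂) * hτσ
  refine ⟨ν, fun S _ _ v p => ?_⟩
  let Θ : Polynomial (Polynomial (RatFunc ℂ)) →ₐ[RatFunc ℂ] S :=
    Polynomial.eval₂AlgHom (Polynomial.aeval v) (-p) (fun _ => Commute.all _ _)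
  have hΘP : Θ P = -p := by simp [Θ, P]
  have hΘu : Θ u = v := by simp [Θ, u]
  have hΘcc : ∀ r, Θ (cc r) = algebraMap _ S r := fun r => by simp [Θ, cc]
  have hΘν : Θ (Polynomial.C ν) = Polynomial.aeval v ν := by simp [Θ]
  have hΘμ : Θ (aeval ![u, -P] μ) = aeval ![v, p] μ := by
    rw [comp_aeval_apply]
    congr 2
    ext1 i
    fin_cases i
    · exact hΘu
    · simp [hΘP]
  have := congrArg Θ hν
  simp only [map_add, map_sub, map_mul, map_ofNat, hΘμ, hΘν, hΘcc, hΘP, hΘu, map_one] at this ⊢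
  linear_combination this

open MvPolynomial in
/-- The chart `r₃` over `r₂` determines the remaining coefficients. -/
theorem coefficients_of_shape_mem {A A' a₁ a₂ a₃ a₄ c₀ d₀ d₁ d₂ s t t' : RatFunc ℂ} {μ : BiPoly}
    {ι : RatFunc ℂ →+* RatF (RatFunc ℂ)} (hι : ι = algebraMap (RatFunc ℂ) (RatF (RatFunc ℂ)))
    {σ τ : RatF (RatFunc ℂ)} (hσ : σ = (tau (RatFunc ℂ))⁻¹) (hτ : τ = tau (RatFunc ℂ))
    (h : ∀ y Z : RatF (RatFunc ℂ), y ∈ regular (RatFunc ℂ) →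
      Z ∈ regular (RatFunc ℂ) → Z ≠ 0 →
      ι A * (σ * Z + ι a₂) ^ 2
        - 2 * ι A * σ * y - 2 * ι A * ι s * (σ * Z + ι a₂)
        + (-2 * y * (σ * Z + ι a₂) + (σ * Z + ι a₂) ^ 2 * Z - ι a₁ * y) * ι c₀
        + ι A' * ((σ * Z - ι a₃) ^ 2 - 2 * ι a₄ * (σ * Z - ι a₃)
          - ι t * (Z - ι a₃ * τ))
        + ι t' * (σ * Z - ι a₃)
        + (σ * Z - ι a₃) * σ
          * (ι d₀ - ι d₁ * σ + ι d₂ * (y - (σ * Z + ι a₂) * Z))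
        + aeval ![y - (σ * Z + ι a₂) * Z, -σ] μ ∈ regular (RatFunc ℂ))
    {ν : Polynomial (RatFunc ℂ)}
    (hμ : ∀ (S : Type) [CommRing S] [Algebra (RatFunc ℂ) S] (u p : S),
      aeval ![u, p] μ = Polynomial.aeval u ν - 2 * algebraMap _ S A * u * p
        + algebraMap _ S (1 - a₃) * p
          * (algebraMap _ S d₀ + algebraMap _ S d₁ * p + algebraMap _ S d₂ * u)) :
    c₀ = 0 ∧ d₀ = 0 ∧ d₁ = 0 ∧ d₂ = 0 ∧ A' = A ∧ 2 * A * (s + a₃ + a₄) = t' ∧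
      ∃ n, ν = Polynomial.C n := by
  have hιmem : ∀ r, ι r ∈ regular (RatFunc ℂ) := fun r => hι ▸ algebraMap_mem_regular r
  have hτmem : τ ∈ regular (RatFunc ℂ) := hτ ▸ tau_mem
  -- For Z = n and y = a₂n the argument y + w collapses to -σn², so each power of σ has a
  -- coefficient polynomial in n.
  have hreg : ∀ n : RatFunc ℂ, n ≠ 0 →
      ι (-2 * A * s * n - 2 * A' * (a₃ + a₄) * n + t' * n - d₀) * σ
        + ι (A' * n ^ 2 - A * n ^ 2 + c₀ * n ^ 3 + d₀ * n + d₁ + d₂ * n ^ 2) * σ ^ 2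
        + ι (-d₁ * n - d₂ * n ^ 3) * σ ^ 3
        + Polynomial.aeval (-σ * ι n ^ 2) ν ∈ regular (RatFunc ℂ) := by
    intro n hn
    have hrest : ι A * ι a₂ ^ 2 - 2 * ι A * ι s * ι a₂
        + (-2 * (ι a₂ * ι n) * ι a₂ + ι a₂ ^ 2 * ι n - ι a₁ * (ι a₂ * ι n)) * ι c₀
        + ι A' * (ι a₃ ^ 2 + 2 * ι a₄ * ι a₃ - ι t * (ι n - ι a₃ * τ)) - ι t' * ι a₃
          ∈ regular (RatFunc ℂ) := by
      repeat' first
        | exact hιmem _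
        | exact hτmem
        | exact ofNat_mem _ 2
        | refine neg_mem ?_
        | refine pow_mem ?_ _
        | refine sub_mem ?_ ?_
        | refine add_mem ?_ ?_
        | refine mul_mem ?_ ?_
    have hn0 : ι n ≠ 0 := by simpa using hn
    have hval := h (ι a₂ * ι n) (ι n) (mul_mem (hιmem _) (hιmem _)) (hιmem n) hn0
    have hu : ι a₂ * ι n - (σ * ι n + ι a₂) * ι n = -σ * ι n ^ 2 := by ring
    rw [hμ, hu, ← hι] at hval
    convert sub_mem hval hrest using 1
    simp only [map_add, map_sub, map_mul, map_neg, map_pow, map_ofNat, map_one]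
    ring
  -- At n = 1 the terms outside ν(-σ) have degree at most three in σ, so ν has degree at most three.
  -- The sign of `e₂` comes from X ↦ -X.
  obtain ⟨n₀, n₁, n₂, n₃, rfl⟩ : ∃ n₀ n₁ n₂ n₃, ν = Polynomial.C n₀ + Polynomial.C n₁ * Polynomial.X
      + Polynomial.C n₂ * Polynomial.X ^ 2 + Polynomial.C n₃ * Polynomial.X ^ 3 := by
    have h1 := hreg 1 one_ne_zero
    generalize -2 * A * s * 1 - 2 * A' * (a₃ + a₄) * 1 + t' * 1 - d₀ = e₁ at h1
    generalize A' * 1 ^ 2 - A * 1 ^ 2 + c₀ * 1 ^ 3 + d₀ * 1 + d₁ + d₂ * 1 ^ 2 = e₂ at h1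
    generalize -d₁ * 1 - d₂ * 1 ^ 3 = e₃ at h1
    obtain ⟨r, hr⟩ := exists_eq_C_of_aeval_inv_mem (R := RatFunc ℂ) (f := Polynomial.C e₁ * Polynomial.X
      + Polynomial.C e₂ * Polynomial.X ^ 2 + Polynomial.C e₃ * Polynomial.X ^ 3
      + ν.comp (-Polynomial.X)) (by
        rw [← hσ]
        convert h1 using 1
        simp [hι, Polynomial.aeval_comp])
    refine ⟨r, e₁, -e₂, e₃, ?_⟩
    have h2 := congrArg (fun f : Polynomial (RatFunc ℂ) => f.comp (-Polynomial.X)) hr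
    simp only [Polynomial.add_comp, Polynomial.mul_comp, Polynomial.C_comp, Polynomial.X_comp,
      Polynomial.pow_comp, Polynomial.comp_assoc, Polynomial.neg_comp, neg_neg,
      Polynomial.comp_X] at h2
    rw [map_neg]
    linear_combination h2
  have key : ∀ n : RatFunc ℂ, n ≠ 0 →
      (-2 * A * s * n - 2 * A' * (a₃ + a₄) * n + t' * n - d₀ - n₁ * n ^ 2 = 0) ∧
      (A' * n ^ 2 - A * n ^ 2 + c₀ * n ^ 3 + d₀ * n + d₁ + d₂ * n ^ 2 + n₂ * n ^ 4 = 0) ∧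
      (-d₁ * n - d₂ * n ^ 3 - n₃ * n ^ 6 = 0) := by
    intro n hn
    have := eq_zero_of_sum_inv_mem (R := RatFunc ℂ)
      (e := ![-2 * A * s * n - 2 * A' * (a₃ + a₄) * n + t' * n - d₀ - n₁ * n ^ 2,
        A' * n ^ 2 - A * n ^ 2 + c₀ * n ^ 3 + d₀ * n + d₁ + d₂ * n ^ 2 + n₂ * n ^ 4,
        -d₁ * n - d₂ * n ^ 3 - n₃ * n ^ 6]) (by
        convert sub_mem (hreg n hn) (hιmem n₀) using 1
        simp only [Fin.sum_univ_three, Matrix.cons_val, Fin.val_zero, Fin.val_one, Fin.val_two,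
          ← hι, ← hσ, map_add, map_sub, map_mul, map_neg, map_pow, Polynomial.aeval_C,
          Polynomial.aeval_X]
        ring)
    exact ⟨this 0, this 1, this 2⟩
  -- The identities hold for every nonzero n. Combining n = ±1 and ±2 separates the odd and even
  -- powers of n and then the individual coefficients.
  obtain ⟨p1, q1, r1⟩ := key 1 one_ne_zero
  obtain ⟨p2, q2, r2⟩ := key 2 two_ne_zero
  obtain ⟨p3, q3, r3⟩ := key 3 three_ne_zero
  obtain ⟨pm, qm, rm⟩ := key (-1) (neg_ne_zero.mpr one_ne_zero)
  obtain ⟨pm2, qm2, rm2⟩ := key (-2) (neg_ne_zero.mpr two_ne_zero)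
  have hn3 : n₃ = 0 := by linear_combination -(r1 + rm) / 2
  subst hn3
  have hd2 : d₂ = 0 := by linear_combination (2 * r1 - r2) / 6
  subst hd2
  have hd1 : d₁ = 0 := by linear_combination -r1
  subst hd1
  have hc0 : c₀ = 0 := by linear_combination (q2 - qm2 - 2 * (q1 - qm)) / 12
  subst hc0
  have hd0 : d₀ = 0 := by linear_combination (q1 - qm) / 2
  subst hd0
  have hn2 : n₂ = 0 := by linear_combination (q2 - 4 * q1) / 12
  subst hn2
  have hA : A' = A := by linear_combination q1
  subst hA
  have hn1 : n₁ = 0 := by linear_combination -(p2 - 2 * p1) / 2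
  subst hn1
  exact ⟨rfl, rfl, rfl, rfl, rfl, by linear_combination -p1, n₀, by simp⟩

/-! ### The system, and the normalization of the Hamiltonian -/

theorem two_mul_invTwoTime : 2 * invTwoTime = invTime := by
  rw [invTwoTime, invTime, ← map_ofNat MvPolynomial.C 2, ← map_mul]
  congr 1
  have := RatFunc.X_ne_zero (K := ℂ)
  field_simp

theorem hamiltonianSystem_hamD52_add_C (α : Fin 5 → ℂ) (c : RatFunc ℂ) :
    hamiltonianSystem (hamD52 α + MvPolynomial.C c) = systemD52 α := by
  have h := two_mul_invTwoTime
  have hT2 : ∀ i, MvPolynomial.pderiv i invTwoTime = 0 := fun i => MvPolynomial.pderiv_C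
  have ht : ∀ i, MvPolynomial.pderiv i timeP = 0 := fun i => MvPolynomial.pderiv_C
  have hc : ∀ i b, MvPolynomial.pderiv i (cstP b) = 0 := fun i b => MvPolynomial.pderiv_C
  have h2 : ∀ i, MvPolynomial.pderiv i (2 : PhasePoly) = 0 := fun i =>
    Derivation.map_natCast (MvPolynomial.pderiv (R := RatFunc ℂ) i) 2
  funext i
  fin_cases i <;>
    simp [hamiltonianSystem, systemD52, hamD52, MvPolynomial.pderiv_X, Derivation.leibniz,
      Derivation.leibniz_pow, hT2, ht, hc, h2, ← h, smul_eq_mul] <;>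
    ring

end

theorem theorem4p2 (α : Fin 5 → ℂ) (hα : α 0 + α 1 + α 2 + α 3 + α 4 = 1)
    (H : PhasePoly) (hdeg : H.totalDegree = 4)
    (h0 : ∃ K, BecomesSystemOf H (chart0 α) K)
    (h1 : ∃ K, BecomesSystemOf H (chart1 α) K)
    (h4 : ∃ K, BecomesSystemOf H (chart4 α) K)
    (h23 : ∃ K₂, BecomesSystemOf H (chart2 α) K₂ ∧ ∃ K₃, BecomesSystemOf K₂ (chart3 α) K₃) :
    hamiltonianSystem H = systemD52 α ∧
      ∃ c : RatFunc ℂ, H = hamD52 α + MvPolynomial.C c := by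
  suffices h : ∃ c : RatFunc ℂ, H = hamD52 α + MvPolynomial.C c by
    obtain ⟨c, rfl⟩ := h
    exact ⟨hamiltonianSystem_hamD52_add_C α c, c, rfl⟩
  obtain ⟨K₀, h0⟩ := h0
  obtain ⟨K₁, h1⟩ := h1
  obtain ⟨K₄, h4⟩ := h4
  obtain ⟨K₂, h2, K₃, h3⟩ := h23
  obtain ⟨a, ha⟩ : ∃ a : Fin 5 → RatFunc ℂ, ∀ i, a i = algebraMap ℂ (RatFunc ℂ) (α i) :=
    ⟨_, fun _ => rfl⟩
  have hsum : a 0 + a 1 + a 2 + a 3 + a 4 = 1 := by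
    simp only [ha, ← map_add, hα, map_one]
  obtain ⟨A, A', c₀, c₁, c₃, d₀, d₁, d₂, μ, hH⟩ :=
    exists_shape_of_charts₀₁₂₄ hdeg.le h0 h1 h2 h4 (ha 0) (ha 1) (ha 2) (ha 4)
  obtain ⟨rfl, rfl⟩ := linear_terms_eq_zero rfl rfl fun x y Z hx hy hZ hZ0 =>
    shape_mem_regular h2 h3 (ha 2) (ha 3) hH rfl hx hy hZ hZ0
  -- Once c₁ = c₃ = 0, points with x = 0 suffice. The ring `R` stays general because it is used both
  -- for ℂ(t)[Y] and for ℂ(t).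
  have hmem : ∀ (R : Type) [CommRing R] [IsDomain R] [Algebra (RatFunc ℂ) R], _ :=
    fun R _ _ _ (y Z : RatF R) (hy : y ∈ regular R) (hZ : Z ∈ regular R) (hZ0 : Z ≠ 0) =>
      shape_mem_regular h2 h3 (ha 2) (ha 3) hH rfl (zero_mem (regular R)) hy hZ hZ0
  simp only [map_zero, zero_mul, mul_zero, add_zero, zero_add, sub_zero, zero_sub, ne_eq,
    OfNat.ofNat_ne_zero, not_false_eq_true, zero_pow] at hmem
  obtain ⟨ν, hν⟩ := exists_eq_of_shape_mem (A := A) (A' := A') (a₁ := a 1) (a₂ := a 2) (a₃ := a 3)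
    (a₄ := a 4) (c₀ := c₀) (d₀ := d₀) (d₁ := d₁) (d₂ := d₂) (s := a 0 + a 1 + a 2)
    (t := RatFunc.X) (t' := 1 / RatFunc.X) (μ := μ) rfl rfl rfl fun y Z hy hZ hZ0 => by
      convert hmem _ y Z hy hZ hZ0 using 1
      ring
  obtain ⟨rfl, rfl, rfl, rfl, rfl, hA, n, rfl⟩ := coefficients_of_shape_mem (A := A) (A' := A')
    (a₁ := a 1) (a₂ := a 2) (a₃ := a 3)
    (a₄ := a 4) (c₀ := c₀) (d₀ := d₀) (d₁ := d₁) (d₂ := d₂) (s := a 0 + a 1 + a 2)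
    (t := RatFunc.X) (t' := 1 / RatFunc.X) (μ := μ) rfl rfl rfl (fun y Z hy hZ hZ0 => by
      convert hmem _ y Z hy hZ hZ0 using 1
      ring) hν
  have hX := RatFunc.X_ne_zero (K := ℂ)
  have hA2 : A' = 1 / (2 * RatFunc.X) := by
    -- The parameters sum to one, so the relation from r₃ becomes 2A' = 1/t.
    have : 2 * A' = 1 / RatFunc.X := by linear_combination hA - 2 * A' * hsum
    field_simp at this ⊢
    linear_combination this
  have hcst : ∀ b, cstP b = MvPolynomial.C (algebraMap ℂ (RatFunc ℂ) b) := fun b => rfl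
  have hT : MvPolynomial.C A' = invTwoTime := by rw [hA2, invTwoTime]
  have hT1 : MvPolynomial.C (1 / RatFunc.X) = invTime := rfl
  refine ⟨n, ?_⟩
  rw [hH, hν, hT, hT1, hamD52]
  -- Writing 1/t as 2·1/(2t) merges -qp/t with the α₄ term into (α₄ - 1)qp/t, and μ = n - 2A'(y +
  -- w)p supplies the coupling with p.
  simp only [hcst, map_add, map_sub, map_zero, map_one, ← ha, Polynomial.aeval_C, ← two_mul_invTwoTime,
    MvPolynomial.algebraMap_eq, hT, timeP]
  ring
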